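/- **Setting.** For a finite word $w$ and an infinite sequence $x$ in the letters $0,1$ write $w\cdot x$ for their concatenation, and let $\mathfrak C=\{0,1\}^{\mathbf N}$. A leaf of a finite rooted binary tree $t$ is identified with the word in $0$ (left edge) and $1$ (right edge) read along the path from the root to it. Thompson's group $V$ is the group of bijections $v$ of $\mathfrak C$ for which there are finite rooted binary trees $t,s$ and a bijection $b:\mathrm{Leaf}(t)\to\mathrm{Leaf}(s)$ with $v(\ell\cdot x)=b(\ell)\cdot x$ for all $\ell\in\mathrm{Leaf}(t)$, $x\in\mathfrak C$. Let $\Gamma$ be a group and $\alpha_0,\alpha_1\in\mathrm{End}(\Gamma)$; for a word $m=m_1\cdots m_k$ put $\alpha_m=\alpha_{m_k}\circ\cdots\circ\alpha_{m_1}$. For a tree $t$ let $\Gamma_t=\Gamma^{\mathrm{Leaf}(t)}$. If the tree $s$ is obtained from $t$ by attaching a tree to each leaf of $t$, let $\Gamma_t\to\Gamma_s$ be the morphism that sends $(g_\ell)_\ell$ to the family whose value at the leaf $\ell\cdot m$ of $s$ (with $\ell\in\mathrm{Leaf}(t)$) is $\alpha_m(g_\ell)$. Let $K=\varinjlim_t\Gamma_t$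 be the direct limit over all trees. The Jones action of $V$ on $K$ by automorphisms is given by $v\cdot[g]=[g\circ b^{-1}]$, for $v$ given by $(t,s,b)$ as above and $g\in\Gamma_t$ (every element of $K$ has a representative in $\Gamma_t$ for such a $t$). The semidirect product $K\rtimes V$ is the fraction group of the triple $(\Gamma,\alpha_0,\alpha_1)$. A morphism between two such limit groups is $V$-equivariant if it intertwines the Jones actions. **Theorem B.** Let $\Gamma,\Lambda$ be groups, let $\alpha\in\mathrm{End}(\Gamma)$, and let $\beta_0,\beta_1\in\mathrm{End}(\Lambda)$ be injective. Let $K\rtimes V$ and $L\rtimes V$ be the fraction groups of the triples $(\Gamma,\alpha,\varepsilon_\Gamma)$ and $(\Lambda,\beta_0,\beta_1)$ respectively, where $\varepsilon_\Gamma$ is the trivial endomorphism of $\Gamma$. 1. If $K$ or $L$ is nontrivial, then there is no isomorphism between the groups $K\rtimes V$ and $L\rtimes V$. 2. If $L$ is nontrivial, then there is no injective $V$-equivariant morphism from $L$ to $K$. 3. Every $V$-equivariant morphism $\theta:K\to L$ takes values in the $V$-invariant elements of $L$, that is, $v\cdot\theta(a)=\theta(a)$ for all $v\in V$, $a\in K$;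 and if $K$ is nontrivial, then there is no injective $V$-equivariant morphism from $K$ to $L$. -/

import Mathlib

noncomputable section

namespace FractionGroups

/-- The Cantor space of infinite binary sequences. -/
abbrev Cantor : Type := ℕ → Bool

/-- The concatenation `w · x` of a finite word with an infinite sequence. -/
def cat : List Bool → Cantor → Cantor
  | [], x => x
  | a :: w, x => fun n => Nat.casesOn n a (cat w x)

/-- Finite rooted ordered binary trees. -/
inductive BTree : Type
  | leaf : BTree
  | node : BTree → BTree → BTree

namespace BTree

/-- `t.IsLeaf w` : the word `w` is the path from the root of `t` to one of its leaves, where `false`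
(the letter `0`) is a left edge and `true` (the letter `1`) a right edge. -/
def IsLeaf : BTree → List Bool → Prop
  | leaf, [] => True
  | leaf, _ :: _ => False
  | node _ _, [] => False
  | node a _, false :: w => a.IsLeaf w
  | node _ b, true :: w => b.IsLeaf w

/-- The leaves of a tree. The leaf `w` is also the standard dyadic interval of all the sequences
with prefix `w`, and the leaves of a tree form a standard dyadic partition of the Cantor space. -/
abbrev Leaf (t : BTree) : Type := {w : List Bool // t.IsLeaf w}

/-- The composition `f ∘ t` of a forest with a tree: the tree `f w` is attached to each leaf `w`
of `t` (the values of `f` at the other words play no role). -/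
def graft : BTree → (List Bool → BTree) → BTree
  | leaf, f => f []
  | node a b, f => node (a.graft fun w => f (false :: w)) (b.graft fun w => f (true :: w))

theorem graft_leaf (t : BTree) : t.graft (fun _ => leaf) = t := by
  induction t with
  | leaf => rfl
  | node a b iha ihb => simp [graft, iha, ihb]

theorem graft_graft (t : BTree) (f g : List Bool → BTree) :
    (t.graft f).graft g = t.graft fun w => (f w).graft fun u => g (w ++ u) := by
  induction t generalizing f g with
  | leaf => rfl
  | node a b iha ihb => simp [graft, iha, ihb]

/-- `t ≤ s` when `s = f ∘ t` for some forest `f`. -/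
instance : Preorder BTree where
  le t s := ∃ f, s = t.graft f
  le_refl t := ⟨_, (graft_leaf t).symm⟩
  le_trans := by
    rintro a _ _ ⟨f, rfl⟩ ⟨g, rfl⟩
    exact ⟨_, graft_graft a f g⟩

theorem exists_common (t s : BTree) : ∃ f g, t.graft f = s.graft g := by
  induction t generalizing s with
  | leaf => exact ⟨fun _ => s, fun _ => leaf, (graft_leaf s).symm⟩
  | node a b iha ihb =>
    cases s with
    | leaf => exact ⟨fun _ => leaf, fun _ => node a b, graft_leaf _⟩
    | node c d =>
      obtain ⟨f, g, h⟩ := iha c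
      obtain ⟨f', g', h'⟩ := ihb d
      refine ⟨fun w => match w with
        | [] => leaf
        | false :: u => f u
        | true :: u => f' u, fun w => match w with
        | [] => leaf
        | false :: u => g u
        | true :: u => g' u, ?_⟩
      simp [graft, h, h']

instance : Nonempty BTree := ⟨leaf⟩

instance : IsDirectedOrder BTree where
  directed t s := by
    obtain ⟨f, g, h⟩ := exists_common t s
    exact ⟨t.graft f, ⟨f, rfl⟩, ⟨g, h⟩⟩

theorem isLeaf_graft (t : BTree) (f : List Bool → BTree) (w : List Bool) :
    (t.graft f).IsLeaf w ↔ ∃ p m, t.IsLeaf p ∧ (f p).IsLeaf m ∧ w = p ++ m := by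
  induction t generalizing f w with
  | leaf =>
    constructor
    · intro h
      exact ⟨[], w, trivial, h, rfl⟩
    · rintro ⟨p, m, hp, hm, rfl⟩
      cases p with
      | nil => exact hm
      | cons a p => exact hp.elim
  | node a b iha ihb =>
    constructor
    · intro h
      match w, h with
      | false :: w, h =>
        obtain ⟨p, m, hp, hm, rfl⟩ := (iha _ _).1 h
        exact ⟨false :: p, m, hp, hm, rfl⟩
      | true :: w, h =>
        obtain ⟨p, m, hp, hm, rfl⟩ := (ihb _ _).1 h
        exact ⟨true :: p, m, hp, hm, rfl⟩
    · rintro ⟨p, m, hp, hm, rfl⟩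
      match p, hp, hm with
      | false :: p, hp, hm => exact (iha _ _).2 ⟨p, m, hp, hm, rfl⟩
      | true :: p, hp, hm => exact (ihb _ _).2 ⟨p, m, hp, hm, rfl⟩

theorem isLeaf_unique (t : BTree) {p q m n : List Bool} (hp : t.IsLeaf p) (hq : t.IsLeaf q)
    (h : p ++ m = q ++ n) : p = q ∧ m = n := by
  induction t generalizing p q with
  | leaf =>
    cases p with
    | nil =>
      cases q with
      | nil => exact ⟨rfl, h⟩
      | cons => exact hq.elim
    | cons => exact hp.elim
  | node a b iha ihb =>
    match p, q, hp, hq, h with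
    | false :: p, false :: q, hp, hq, h =>
      obtain ⟨rfl, rfl⟩ := iha hp hq (List.cons.inj h).2
      exact ⟨rfl, rfl⟩
    | true :: p, true :: q, hp, hq, h =>
      obtain ⟨rfl, rfl⟩ := ihb hp hq (List.cons.inj h).2
      exact ⟨rfl, rfl⟩
    | false :: p, true :: q, hp, hq, h => simp at h
    | true :: p, false :: q, hp, hq, h => simp at h

theorem exists_prefix {t s : BTree} (h : t ≤ s) (q : s.Leaf) :
    ∃ (p : t.Leaf) (m : List Bool), q.1 = p.1 ++ m := by
  obtain ⟨f, rfl⟩ := h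
  obtain ⟨p, m, hp, -, hq⟩ := (isLeaf_graft t f q.1).1 q.2
  exact ⟨⟨p, hp⟩, m, hq⟩

/-- For `s = f ∘ t`, the leaf of `t` below which a given leaf of `s` lies. -/
def parent {t s : BTree} (h : t ≤ s) (q : s.Leaf) : t.Leaf := (exists_prefix h q).choose

/-- For `s = f ∘ t`, the path in the tree `f_ℓ` from its root (a leaf `ℓ` of `t`) to a given leaf
of `s`. -/
def path {t s : BTree} (h : t ≤ s) (q : s.Leaf) : List Bool := (exists_prefix h q).choose_spec.choose

theorem parent_append_path {t s : BTree} (h : t ≤ s) (q : s.Leaf) :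
    q.1 = (parent h q).1 ++ path h q := (exists_prefix h q).choose_spec.choose_spec

theorem parent_path_eq {t s : BTree} (h : t ≤ s) (q : s.Leaf) (p : t.Leaf) (m : List Bool)
    (hq : q.1 = p.1 ++ m) : parent h q = p ∧ path h q = m := by
  obtain ⟨h1, h2⟩ := isLeaf_unique t (parent h q).2 p.2 ((parent_append_path h q).symm.trans hq)
  exact ⟨Subtype.ext h1, h2⟩

end BTree

open BTree

theorem cat_append (u w : List Bool) (x : Cantor) : cat (u ++ w) x = cat u (cat w x) := by
  induction u with
  | nil => rfl
  | cons a u ih => simp [cat, ih]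

theorem cat_cons_inj {a b : Bool} {u w : List Bool} {x y : Cantor}
    (h : cat (a :: u) x = cat (b :: w) y) : a = b ∧ cat u x = cat w y :=
  ⟨congrFun h 0, funext fun n => congrFun h (n + 1)⟩

theorem cat_left_injective {u w : List Bool} (h : ∀ x, cat u x = cat w x) : u = w := by
  induction u generalizing w with
  | nil =>
    cases w with
    | nil => rfl
    | cons a w =>
      have := congrFun (h fun _ => !a) 0
      simp [cat] at this
  | cons a u ih =>
    cases w with
    | nil =>
      have := congrFun (h fun _ => !a) 0
      simp [cat] at this
    | cons b w =>
      have hab := (cat_cons_inj (h fun _ => true)).1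
      subst hab
      rw [ih fun x => (cat_cons_inj (h x)).2]

/-- `v` is the bijection of the Cantor space that carries the standard dyadic partition of `t` onto
that of `s` along the bijection `b` between their leaves: `v (ℓ · x) = b ℓ · x`. -/
def Carries (v : Equiv.Perm Cantor) (t s : BTree) (b : t.Leaf ≃ s.Leaf) : Prop :=
  ∀ (l : t.Leaf) (x : Cantor), v (cat l.1 x) = cat (b l).1 x

theorem Carries.symm {v : Equiv.Perm Cantor} {t s : BTree} {b : t.Leaf ≃ s.Leaf}
    (h : Carries v t s b) : Carries v⁻¹ s t b.symm := by
  intro l x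
  rw [Equiv.Perm.inv_eq_iff_eq, h, Equiv.apply_symm_apply]

theorem Carries.mul {v w : Equiv.Perm Cantor} {r s t : BTree} {b : r.Leaf ≃ s.Leaf}
    {c : s.Leaf ≃ t.Leaf} (hv : Carries v r s b) (hw : Carries w s t c) :
    Carries (w * v) r t (b.trans c) := by
  intro l x
  rw [Equiv.Perm.mul_apply, hv, hw, Equiv.trans_apply]

theorem Carries.one (t : BTree) : Carries 1 t t (Equiv.refl _) := fun _ _ => rfl

/-- A bijection carrying `t` to `s` carries each refinement of `t` to a refinement of `s`. -/
theorem Carries.refine {v : Equiv.Perm Cantor} {t s u : BTree} {b : t.Leaf ≃ s.Leaf}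
    (h : Carries v t s b) (htu : t ≤ u) :
    ∃ (r : BTree) (_ : s ≤ r) (c : u.Leaf ≃ r.Leaf), Carries v u r c ∧
      ∀ q : u.Leaf, (c q).1 = (b (parent htu q)).1 ++ path htu q := by
  classical
  obtain ⟨f, hf⟩ := id htu
  let g : List Bool → BTree := fun w => if hw : s.IsLeaf w then f (b.symm ⟨w, hw⟩).1 else leaf
  have hg : ∀ p : t.Leaf, g (b p).1 = f p.1 := by
    intro p
    have : (⟨(b p).1, (b p).2⟩ : s.Leaf) = b p := rfl
    simp only [g, dif_pos (b p).2, this, Equiv.symm_apply_apply]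
  have hmem : ∀ (p : t.Leaf) (m : List Bool), u.IsLeaf (p.1 ++ m) → (f p.1).IsLeaf m := by
    intro p m hm
    rw [hf, isLeaf_graft] at hm
    obtain ⟨p', m', hp', hm', he⟩ := hm
    obtain ⟨rfl, rfl⟩ := isLeaf_unique t p.2 hp' he
    exact hm'
  have hto : ∀ q : u.Leaf, (s.graft g).IsLeaf ((b (parent htu q)).1 ++ path htu q) := by
    intro q
    refine (isLeaf_graft _ _ _).2 ⟨_, _, (b _).2, ?_, rfl⟩
    rw [hg]
    apply hmem
    rw [← parent_append_path]
    exact q.2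
  let c : u.Leaf → (s.graft g).Leaf := fun q => ⟨_, hto q⟩
  have hc : Function.Bijective c := by
    constructor
    · intro q q' he
      obtain ⟨h1, h2⟩ := isLeaf_unique s (b (parent htu q)).2 (b (parent htu q')).2
        (congrArg Subtype.val he)
      have h3 := b.injective (Subtype.ext h1)
      apply Subtype.ext
      rw [parent_append_path htu q, parent_append_path htu q', h2, h3]
    · intro r
      obtain ⟨p, m, hp, hm, he⟩ := (isLeaf_graft s g r.1).1 r.2
      obtain ⟨l, hl⟩ := b.surjective ⟨p, hp⟩
      have hpl : (b l).1 = p := congrArg Subtype.val hl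
      rw [← hpl, hg] at hm
      have hu : u.IsLeaf (l.1 ++ m) := by
        rw [hf]
        exact (isLeaf_graft _ _ _).2 ⟨_, _, l.2, hm, rfl⟩
      obtain ⟨h1, h2⟩ := parent_path_eq htu ⟨_, hu⟩ l m rfl
      refine ⟨⟨_, hu⟩, Subtype.ext ?_⟩
      change (b (parent htu ⟨_, hu⟩)).1 ++ path htu ⟨_, hu⟩ = r.1
      rw [h1, h2, hpl, he]
  refine ⟨s.graft g, ⟨g, rfl⟩, Equiv.ofBijective c hc, ?_, fun q => rfl⟩
  intro q x
  change v (cat q.1 x) = cat ((b (parent htu q)).1 ++ path htu q) x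
  rw [parent_append_path htu q, cat_append, h, cat_append]

/-- Thompson's group `V`: the bijections (in fact homeomorphisms) of the Cantor space that carry
one standard dyadic partition onto another by exchanging prefixes. -/
def ThompsonV : Subgroup (Equiv.Perm Cantor) where
  carrier := {v | ∃ (t s : BTree) (b : t.Leaf ≃ s.Leaf), Carries v t s b}
  one_mem' := ⟨leaf, leaf, _, Carries.one leaf⟩
  inv_mem' := by
    rintro v ⟨t, s, b, h⟩
    exact ⟨s, t, b.symm, h.symm⟩
  mul_mem' := by
    rintro w v ⟨t', s', b', hw⟩ ⟨t, s, b, hv⟩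
    obtain ⟨u, hsu, htu⟩ := exists_ge_ge s t'
    obtain ⟨r, -, c, hc, -⟩ := hv.symm.refine hsu
    obtain ⟨r', -, c', hc', -⟩ := hw.refine htu
    rw [inv_inv v |>.symm]
    exact ⟨r, r', _, hc.symm.mul hc'⟩

section Limit

variable {Γ : Type*} [Group Γ] (α₀ α₁ : Γ →* Γ)

/-- `α_m = α_{m_k} ∘ ⋯ ∘ α_{m_1}` for a word `m = m_1 ⋯ m_k`. -/
def wordEnd : List Bool → Γ →* Γ
  | [] => MonoidHom.id Γ
  | a :: m => (wordEnd m).comp (bif a then α₁ else α₀)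

theorem wordEnd_append (u w : List Bool) (g : Γ) :
    wordEnd α₀ α₁ (u ++ w) g = wordEnd α₀ α₁ w (wordEnd α₀ α₁ u g) := by
  induction u generalizing g with
  | nil => rfl
  | cons a u ih => simp [wordEnd, ih]

/-- The map `Φ(f) : Γ_t → Γ_{f ∘ t}`, where `Γ_t` is the group of maps from the leaves of `t` to
`Γ`, and `Φ` is the monoidal functor with `Φ(1) = Γ` and `Φ(Y) = (α₀, α₁)`: below the leaf `ℓ` of
`t`, the value at the leaf of `f_ℓ` with path `m` is `α_m (g ℓ)`. -/
def transition (t s : BTree) (h : t ≤ s) : (t.Leaf → Γ) →* (s.Leaf → Γ) where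
  toFun g q := wordEnd α₀ α₁ (path h q) (g (parent h q))
  map_one' := by funext q; simp
  map_mul' g g' := by funext q; simp

theorem transition_apply {t s : BTree} (h : t ≤ s) (g : t.Leaf → Γ) (q : s.Leaf) (p : t.Leaf)
    (m : List Bool) (hq : q.1 = p.1 ++ m) :
    transition α₀ α₁ t s h g q = wordEnd α₀ α₁ m (g p) := by
  obtain ⟨h1, h2⟩ := parent_path_eq h q p m hq
  simp [transition, h1, h2]

instance : DirectedSystem (fun t : BTree => t.Leaf → Γ) (transition α₀ α₁ · · ·) where
  map_self t g := by
    funext q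
    exact transition_apply α₀ α₁ _ g q q [] (by simp)
  map_map r s t hts hsr g := by
    funext q
    have h1 := parent_append_path hsr q
    have h2 := parent_append_path hts (parent hsr q)
    rw [transition_apply α₀ α₁ hsr _ q _ _ h1, transition_apply α₀ α₁ hts g _ _ _ h2,
      transition_apply α₀ α₁ (hts.trans hsr) g q (parent hts (parent hsr q))
        (path hts (parent hsr q) ++ path hsr q) (by rw [← List.append_assoc, ← h2, ← h1]),
      wordEnd_append]

/-- The limit group `K = lim Γ_t` over all trees `t`. -/
abbrev LimitGroup : Type _ := DirectLimit (fun t : BTree => t.Leaf → Γ) (transition α₀ α₁)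

/-- The class in the limit group of an element of `Γ_t`. -/
def cls {t : BTree} (g : t.Leaf → Γ) : LimitGroup α₀ α₁ := ⟦⟨t, g⟩⟧

theorem cls_transition {t s : BTree} (h : t ≤ s) (g : t.Leaf → Γ) :
    cls α₀ α₁ (transition α₀ α₁ t s h g) = cls α₀ α₁ g :=
  DirectLimit.mk_apply (F := fun t : BTree => t.Leaf → Γ) (f := transition α₀ α₁) t s g h

theorem cls_mul {t : BTree} (g g' : t.Leaf → Γ) :
    cls α₀ α₁ (g * g') = cls α₀ α₁ g * cls α₀ α₁ g' :=
  (DirectLimit.mul_def (G := fun t : BTree => t.Leaf → Γ) (f := transition α₀ α₁) t g g').symm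

theorem cls_eq {t s : BTree} {g : t.Leaf → Γ} {h : s.Leaf → Γ} :
    cls α₀ α₁ g = cls α₀ α₁ h ↔ ∃ (u : BTree) (hx : t ≤ u) (hy : s ≤ u),
      transition α₀ α₁ t u hx g = transition α₀ α₁ s u hy h :=
  Quotient.eq

/-- A refinement of a pair of partitions computes the same transported element. -/
theorem Carries.refine_cls {v : Equiv.Perm Cantor} {t s u : BTree} {b : t.Leaf ≃ s.Leaf}
    (h : Carries v t s b) (htu : t ≤ u) :
    ∃ (r : BTree) (_ : s ≤ r) (c : u.Leaf ≃ r.Leaf), Carries v u r c ∧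
      ∀ g : t.Leaf → Γ, cls α₀ α₁ (transition α₀ α₁ t u htu g ∘ c.symm) =
        cls α₀ α₁ (g ∘ b.symm) := by
  obtain ⟨r, hr, c, hc, hcq⟩ := h.refine htu
  refine ⟨r, hr, c, hc, fun g => ?_⟩
  rw [← cls_transition α₀ α₁ hr (g ∘ b.symm)]
  congr 1
  funext q
  obtain ⟨l, rfl⟩ := c.surjective q
  rw [transition_apply α₀ α₁ hr _ _ _ _ (hcq l)]
  simp [transition]

/-- The transported element does not depend on the chosen representatives. -/
theorem cls_transport_congr {v : Equiv.Perm Cantor} {t s t' s' : BTree} {b : t.Leaf ≃ s.Leaf}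
    {b' : t'.Leaf ≃ s'.Leaf} (h : Carries v t s b) (h' : Carries v t' s' b')
    {g : t.Leaf → Γ} {g' : t'.Leaf → Γ} (hg : cls α₀ α₁ g = cls α₀ α₁ g') :
    cls α₀ α₁ (g ∘ b.symm) = cls α₀ α₁ (g' ∘ b'.symm) := by
  obtain ⟨u, hx, hy, he⟩ := (cls_eq α₀ α₁).1 hg
  obtain ⟨r, -, c, hc, hcg⟩ := h.refine_cls α₀ α₁ hx
  obtain ⟨r', -, c', hc', hcg'⟩ := h'.refine_cls α₀ α₁ hy
  rw [← hcg, ← hcg', he]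
  have hcc : ∀ l : u.Leaf, (c l).1 = (c' l).1 := fun l =>
    cat_left_injective fun x => (hc l x).symm.trans (hc' l x)
  obtain ⟨w, hw, hw'⟩ := exists_ge_ge r r'
  rw [cls_eq]
  refine ⟨w, hw, hw', ?_⟩
  funext q
  obtain ⟨l, hl⟩ := c.surjective (parent hw q)
  have hq := parent_append_path hw q
  rw [← hl] at hq
  rw [transition_apply α₀ α₁ hw _ q _ _ hq,
    transition_apply α₀ α₁ hw' _ q (c' l) _ (by rw [← hcc]; exact hq)]
  simp

theorem exists_rep (v : ThompsonV) (k k' : LimitGroup α₀ α₁) :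
    ∃ (t s : BTree) (b : t.Leaf ≃ s.Leaf) (g g' : t.Leaf → Γ),
      Carries v.1 t s b ∧ k = cls α₀ α₁ g ∧ k' = cls α₀ α₁ g' := by
  obtain ⟨t, s, b, h⟩ := v.2
  obtain ⟨r, g, g', rfl, rfl⟩ := DirectLimit.exists_eq_mk₂ (transition α₀ α₁) k k'
  obtain ⟨u, htu, hru⟩ := exists_ge_ge t r
  obtain ⟨r', -, c, hc, -⟩ := h.refine htu
  exact ⟨u, r', c, _, _, hc, (cls_transition α₀ α₁ hru g).symm,
    (cls_transition α₀ α₁ hru g').symm⟩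

/-- `k'` is the image of `k` under `v` for the Jones action: `k` is the class of some
`g ∈ Γ_t`, where `v` is given by the trees `t`, `s` and the bijection `b` between their leaves,
and `k'` is the class of `g ∘ b⁻¹ ∈ Γ_s`. -/
def JonesRel (v : ThompsonV) (k k' : LimitGroup α₀ α₁) : Prop :=
  ∃ (t s : BTree) (b : t.Leaf ≃ s.Leaf) (g : t.Leaf → Γ),
    Carries v.1 t s b ∧ k = cls α₀ α₁ g ∧ k' = cls α₀ α₁ (g ∘ b.symm)

theorem exists_jonesRel (v : ThompsonV) (k : LimitGroup α₀ α₁) : ∃ k', JonesRel α₀ α₁ v k k' := by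
  obtain ⟨t, s, b, g, -, h, hk, -⟩ := exists_rep α₀ α₁ v k k
  exact ⟨_, t, s, b, g, h, hk, rfl⟩

/-- The Jones action, as a map. -/
def jonesFun (v : ThompsonV) (k : LimitGroup α₀ α₁) : LimitGroup α₀ α₁ :=
  (exists_jonesRel α₀ α₁ v k).choose

theorem jonesFun_cls (v : ThompsonV) {t s : BTree} {b : t.Leaf ≃ s.Leaf}
    (h : Carries v.1 t s b) (g : t.Leaf → Γ) :
    jonesFun α₀ α₁ v (cls α₀ α₁ g) = cls α₀ α₁ (g ∘ b.symm) := by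
  obtain ⟨t', s', b', g', h', hk, hk'⟩ := (exists_jonesRel α₀ α₁ v (cls α₀ α₁ g)).choose_spec
  exact hk'.trans (cls_transport_congr α₀ α₁ h' h hk.symm)

theorem jonesFun_map_mul (v : ThompsonV) (k k' : LimitGroup α₀ α₁) :
    jonesFun α₀ α₁ v (k * k') = jonesFun α₀ α₁ v k * jonesFun α₀ α₁ v k' := by
  obtain ⟨t, s, b, g, g', h, rfl, rfl⟩ := exists_rep α₀ α₁ v k k'
  rw [← cls_mul, jonesFun_cls α₀ α₁ v h, jonesFun_cls α₀ α₁ v h, jonesFun_cls α₀ α₁ v h, ← cls_mul]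
  rfl

theorem jonesFun_one (k : LimitGroup α₀ α₁) : jonesFun α₀ α₁ 1 k = k := by
  obtain ⟨t, g, rfl⟩ := DirectLimit.exists_eq_mk (transition α₀ α₁) k
  exact jonesFun_cls α₀ α₁ 1 (Carries.one t) g

theorem jonesFun_mul (w v : ThompsonV) (k : LimitGroup α₀ α₁) :
    jonesFun α₀ α₁ (w * v) k = jonesFun α₀ α₁ w (jonesFun α₀ α₁ v k) := by
  obtain ⟨t, s, b, g, -, hv, rfl, -⟩ := exists_rep α₀ α₁ v k k
  obtain ⟨t', s', b', hw⟩ := w.2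
  obtain ⟨u, hsu, htu⟩ := exists_ge_ge s t'
  obtain ⟨r, hr, c, hc, -⟩ := hv.symm.refine hsu
  obtain ⟨r', -, c', hc', -⟩ := hw.refine htu
  have hc2 : Carries v.1 r u c.symm := by simpa using hc.symm
  have hm : Carries (w * v).1 r r' (c.symm.trans c') := hc2.mul hc'
  rw [← cls_transition α₀ α₁ hr g, jonesFun_cls α₀ α₁ _ hm, jonesFun_cls α₀ α₁ _ hc2,
    jonesFun_cls α₀ α₁ _ hc']
  rfl

/-- The Jones action `V ↷ K` of the triple `(Γ, α₀, α₁)`, by group automorphisms. -/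
def jonesAction : ThompsonV →* MulAut (LimitGroup α₀ α₁) where
  toFun v :=
    { toFun := jonesFun α₀ α₁ v
      invFun := jonesFun α₀ α₁ v⁻¹
      left_inv := fun k => by rw [← jonesFun_mul, inv_mul_cancel, jonesFun_one]
      right_inv := fun k => by rw [← jonesFun_mul, mul_inv_cancel, jonesFun_one]
      map_mul' := jonesFun_map_mul α₀ α₁ v }
  map_one' := MulEquiv.ext (jonesFun_one α₀ α₁)
  map_mul' w v := MulEquiv.ext (jonesFun_mul α₀ α₁ w v)

/-- The fraction group `K ⋊ V` of the triple `(Γ, α₀, α₁)`. -/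
abbrev FractionGroup : Type _ := LimitGroup α₀ α₁ ⋊[jonesAction α₀ α₁] ThompsonV

end Limit

/-- A morphism between the limit groups of two triples is `V`-equivariant if it intertwines the
Jones actions. -/
def IsEquivariant {Γ Λ : Type*} [Group Γ] [Group Λ] {α₀ α₁ : Γ →* Γ} {β₀ β₁ : Λ →* Λ}
    (θ : LimitGroup α₀ α₁ →* LimitGroup β₀ β₁) : Prop :=
  ∀ (v : ThompsonV) (a : LimitGroup α₀ α₁),
    θ (jonesAction α₀ α₁ v a) = jonesAction β₀ β₁ v (θ a)

end FractionGroups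

end

noncomputable section

namespace FractionGroups

open BTree

/-! ### Restriction of elements of the limit group to cones -/

section Restriction

variable {Γ : Type*} [Group Γ] (α₀ α₁ : Γ →* Γ)

/-! An element of a limit group is determined by its restrictions to the cones of all words of a
given length, and `V` acts by moving these restrictions along prefix exchanges
(`restrict_jonesAction`). In particular, swapping two disjoint cones on which an element has equal
restrictions fixes it (`jonesAction_coneSwap_eq`). The two limit groups differ in their supports:
every `a` in `K` is trivial on the cone of `w1` for all long `w`, while a nontrivial `L` contains
some `k` trivial on the cone of `1` and nontrivial on every subcone of the cone of `0`.

Equivariant morphisms: a swap fixing `a` fixes `θ a`. From `L` to `K`, `θ k` is trivial on a subcone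
of each half, and swapping these subcones fixes `θ k` but not `k`. From `K` to `L`, swapping `w1`
with `w'1` fixes `a`, so `θ a` agrees on these cones, hence on `w` and `w'` by injectivity of the
`β`'s; thus `θ a` is constant on long words and therefore invariant.

Isomorphisms: a double commutator argument shows that two commuting subgroups of `V` normalized by
enough swaps cannot both be nontrivial (`not_commuting_of_moves`). First, this makes every
surjection onto `V` kill the limit group (`map_inl_eq_one`), so an isomorphism `φ` matches `K` with
`L` and induces an injective `κ : V → V`. Second, let `φ u = k`. The stabilizer of `u` in `V`
corresponds to elements preserving the support of `k`, hence normalizes the `κ`-images of the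
pointwise fixers of the two half cones. These images commute and are nontrivial, yet the stabilizer
contains all swaps of cones on which `u` vanishes, and every cone contains such a cone: a
contradiction. -/

theorem exists_eq_cls (k : LimitGroup α₀ α₁) :
    ∃ (t : BTree) (g : t.Leaf → Γ), k = cls α₀ α₁ g := by
  obtain ⟨t, g, rfl⟩ := DirectLimit.exists_eq_mk (transition α₀ α₁) k
  exact ⟨t, g, rfl⟩

theorem cls_one (t : BTree) : cls α₀ α₁ (1 : t.Leaf → Γ) = 1 :=
  (DirectLimit.one_def (G := fun t : BTree => t.Leaf → Γ) (f := transition α₀ α₁) t).symm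

theorem cls_eq_one_iff {t : BTree} {g : t.Leaf → Γ} :
    cls α₀ α₁ g = 1 ↔ ∃ (u : BTree) (h : t ≤ u), transition α₀ α₁ t u h g = 1 := by
  constructor
  · intro h
    rw [← cls_one α₀ α₁ t, cls_eq] at h
    obtain ⟨u, hx, hy, he⟩ := h
    exact ⟨u, hx, he.trans (map_one _)⟩
  · rintro ⟨u, h, he⟩
    rw [← cls_transition α₀ α₁ h g, he, cls_one]

/-- The class of an element of `Γ` placed at the root. -/
def rootCls : Γ →* LimitGroup α₀ α₁ where
  toFun g := cls α₀ α₁ (t := leaf) fun _ => g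
  map_one' := cls_one α₀ α₁ leaf
  map_mul' g h := cls_mul α₀ α₁ (t := leaf) (fun _ => g) fun _ => h

/-- The endomorphism attached to a letter. -/
abbrev letterEnd (b : Bool) : Γ →* Γ := bif b then α₁ else α₀

/-- The subtree at a child of the root. -/
def child : BTree → Bool → BTree
  | leaf, _ => leaf
  | node l _, false => l
  | node _ r, true => r

theorem isLeaf_node_cons {l r : BTree} {b : Bool} {w : List Bool} :
    (node l r).IsLeaf (b :: w) ↔ (child (node l r) b).IsLeaf w := by
  cases b <;> rfl

/-- The restriction to the cone of a letter of the class of an element of `Γ_t`. -/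
def restrictRep (b : Bool) : (t : BTree) → (t.Leaf → Γ) → LimitGroup α₀ α₁
  | leaf, g => rootCls α₀ α₁ (letterEnd α₀ α₁ b (g ⟨[], trivial⟩))
  | node l r, g => cls α₀ α₁ (t := child (node l r) b) fun q =>
      g ⟨b :: q.1, isLeaf_node_cons.2 q.2⟩

theorem leaf_le (t : BTree) : leaf ≤ t := ⟨fun _ => t, rfl⟩

theorem node_le_node {l r l' r' : BTree} :
    node l r ≤ node l' r' ↔ l ≤ l' ∧ r ≤ r' := by
  constructor
  · rintro ⟨f, hf⟩
    simp only [graft, node.injEq] at hf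
    exact ⟨⟨_, hf.1⟩, ⟨_, hf.2⟩⟩
  · rintro ⟨⟨f, rfl⟩, ⟨g, rfl⟩⟩
    exact ⟨fun w => match w with
      | [] => leaf
      | false :: u => f u
      | true :: u => g u, rfl⟩

theorem child_le_child {l r l' r' : BTree} (h : node l r ≤ node l' r') (b : Bool) :
    child (node l r) b ≤ child (node l' r') b := by
  cases b
  · exact (node_le_node.1 h).1
  · exact (node_le_node.1 h).2

theorem transition_node {l r l' r' : BTree} (h : node l r ≤ node l' r') (b : Bool)
    (g : (node l r).Leaf → Γ) (q : (child (node l' r') b).Leaf) :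
    transition α₀ α₁ _ _ h g ⟨b :: q.1, isLeaf_node_cons.2 q.2⟩ =
      transition α₀ α₁ _ _ (child_le_child h b)
        (fun p => g ⟨b :: p.1, isLeaf_node_cons.2 p.2⟩) q := by
  have hq := parent_append_path (child_le_child h b) q
  rw [transition_apply α₀ α₁ (child_le_child h b) _ q _ _ hq]
  apply transition_apply
  simp only [List.cons_append, ← hq]

theorem restrictRep_transition (b : Bool) {t s : BTree} (h : t ≤ s) (g : t.Leaf → Γ) :
    restrictRep α₀ α₁ b s (transition α₀ α₁ t s h g) = restrictRep α₀ α₁ b t g := by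
  match t, s, h, g with
  | leaf, leaf, h, g =>
    simp only [restrictRep]
    rw [transition_apply α₀ α₁ h g _ ⟨[], trivial⟩ [] rfl]
    rfl
  | leaf, node l r, h, g =>
    simp only [restrictRep, rootCls, MonoidHom.coe_mk, OneHom.coe_mk]
    rw [← cls_transition α₀ α₁ (leaf_le (child (node l r) b))]
    congr 1
    funext q
    rw [transition_apply α₀ α₁ h g _ ⟨[], trivial⟩ (b :: q.1) rfl,
      transition_apply α₀ α₁ (leaf_le _) _ q ⟨[], trivial⟩ q.1 rfl]
    rfl
  | node l r, leaf, h, g => obtain ⟨f, hf⟩ := h; simp [graft] at hf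
  | node l r, node l' r', h, g =>
    simp only [restrictRep]
    rw [← cls_transition α₀ α₁ (child_le_child h b)]
    congr 1
    funext q
    exact transition_node α₀ α₁ h b g q

theorem restrictRep_mul (b : Bool) (t : BTree) (g g' : t.Leaf → Γ) :
    restrictRep α₀ α₁ b t (g * g') = restrictRep α₀ α₁ b t g * restrictRep α₀ α₁ b t g' := by
  cases t with
  | leaf => simp [restrictRep]
  | node l r =>
    simp only [restrictRep]
    rw [← cls_mul]
    rfl

/-- The restriction of an element of the limit group to the cone of a letter, rescaled to the whole
Cantor space. -/
def restrictLetter (b : Bool) : LimitGroup α₀ α₁ →* LimitGroup α₀ α₁ :=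
  MonoidHom.mk' (Quotient.lift (fun x : Σ t : BTree, t.Leaf → Γ => restrictRep α₀ α₁ b x.1 x.2) (by
    rintro ⟨t, g⟩ ⟨s, h⟩ ⟨u, hx, hy, he⟩
    change restrictRep α₀ α₁ b t g = restrictRep α₀ α₁ b s h
    rw [← restrictRep_transition α₀ α₁ b hx, ← restrictRep_transition α₀ α₁ b hy]
    exact congrArg _ he)) (by
    intro k k'
    obtain ⟨t, g, g', rfl, rfl⟩ := DirectLimit.exists_eq_mk₂ (transition α₀ α₁) k k'
    change Quotient.lift _ _ (cls α₀ α₁ g * cls α₀ α₁ g') = _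
    rw [← cls_mul]
    exact restrictRep_mul α₀ α₁ b t g g')

theorem restrictLetter_rootCls (b : Bool) (g : Γ) :
    restrictLetter α₀ α₁ b (rootCls α₀ α₁ g) = rootCls α₀ α₁ (letterEnd α₀ α₁ b g) := rfl

/-- The refinements that witness triviality on the two halves can be chosen independently and joined
under one root. -/
theorem eq_one_of_restrictLetter {k : LimitGroup α₀ α₁}
    (h : ∀ b, restrictLetter α₀ α₁ b k = 1) : k = 1 := by
  obtain ⟨t, g, rfl⟩ := exists_eq_cls α₀ α₁ k
  obtain ⟨l, r, hs⟩ : ∃ l r, t ≤ node l r := by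
    cases t with
    | leaf => exact ⟨leaf, leaf, leaf_le _⟩
    | node l r => exact ⟨l, r, le_rfl⟩
  rw [← cls_transition α₀ α₁ hs g] at h ⊢
  generalize transition α₀ α₁ t _ hs g = g' at h
  obtain ⟨l', hl, el⟩ := (cls_eq_one_iff α₀ α₁).1 (h false)
  obtain ⟨r', hr, er⟩ := (cls_eq_one_iff α₀ α₁).1 (h true)
  have hn : node l r ≤ node l' r' := node_le_node.2 ⟨hl, hr⟩
  refine (cls_eq_one_iff α₀ α₁).2 ⟨_, hn, ?_⟩
  funext ⟨q, hq⟩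
  match q, hq with
  | false :: q, hq =>
    exact (transition_node α₀ α₁ hn false g' ⟨q, hq⟩).trans (congrFun el ⟨q, hq⟩)
  | true :: q, hq =>
    exact (transition_node α₀ α₁ hn true g' ⟨q, hq⟩).trans (congrFun er ⟨q, hq⟩)

theorem exists_restrictLetter (x y : LimitGroup α₀ α₁) :
    ∃ k, restrictLetter α₀ α₁ false k = x ∧ restrictLetter α₀ α₁ true k = y := by
  obtain ⟨l, g, rfl⟩ := exists_eq_cls α₀ α₁ x
  obtain ⟨r, h, rfl⟩ := exists_eq_cls α₀ α₁ y
  refine ⟨cls α₀ α₁ (t := node l r) fun q => match q with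
    | ⟨false :: w, hw⟩ => g ⟨w, hw⟩
    | ⟨true :: w, hw⟩ => h ⟨w, hw⟩, rfl, rfl⟩

/-- The restriction of an element of the limit group to the cone of a word, rescaled to the whole
Cantor space. -/
def restrict : List Bool → LimitGroup α₀ α₁ →* LimitGroup α₀ α₁
  | [] => MonoidHom.id _
  | b :: w => (restrict w).comp (restrictLetter α₀ α₁ b)

theorem restrict_cons (b : Bool) (w : List Bool) (k : LimitGroup α₀ α₁) :
    restrict α₀ α₁ (b :: w) k = restrict α₀ α₁ w (restrictLetter α₀ α₁ b k) := rfl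

theorem restrict_append (u w : List Bool) (k : LimitGroup α₀ α₁) :
    restrict α₀ α₁ (u ++ w) k = restrict α₀ α₁ w (restrict α₀ α₁ u k) := by
  induction u generalizing k with
  | nil => rfl
  | cons b u ih => exact ih _

theorem restrict_rootCls (w : List Bool) (g : Γ) :
    restrict α₀ α₁ w (rootCls α₀ α₁ g) = rootCls α₀ α₁ (wordEnd α₀ α₁ w g) := by
  induction w generalizing g with
  | nil => rfl
  | cons b w ih =>
    rw [restrict_cons, restrictLetter_rootCls, ih]
    rfl

theorem restrict_cls_leaf {t : BTree} (g : t.Leaf → Γ) (l : t.Leaf) :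
    restrict α₀ α₁ l.1 (cls α₀ α₁ g) = rootCls α₀ α₁ (g l) := by
  induction t with
  | leaf =>
    obtain ⟨w, hw⟩ := l
    cases w with
    | nil =>
      refine congrArg (cls α₀ α₁) (funext fun q => congrArg g (Subtype.ext ?_))
      obtain ⟨_ | ⟨b, q⟩, hq⟩ := q
      · rfl
      · exact hq.elim
    | cons b w => exact hw.elim
  | node a b iha ihb =>
    obtain ⟨w, hw⟩ := l
    match w, hw with
    | false :: w, hw => exact iha (fun q => g ⟨false :: q.1, q.2⟩) ⟨w, hw⟩
    | true :: w, hw => exact ihb (fun q => g ⟨true :: q.1, q.2⟩) ⟨w, hw⟩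

theorem eq_one_of_restrict (n : ℕ) {k : LimitGroup α₀ α₁}
    (h : ∀ w : List Bool, w.length = n → restrict α₀ α₁ w k = 1) : k = 1 := by
  induction n generalizing k with
  | zero => exact h [] rfl
  | succ n ih =>
    exact eq_one_of_restrictLetter α₀ α₁ fun b => ih fun w hw => h (b :: w) (by simp [hw])

theorem eq_of_restrict (n : ℕ) {k k' : LimitGroup α₀ α₁}
    (h : ∀ w : List Bool, w.length = n → restrict α₀ α₁ w k = restrict α₀ α₁ w k') : k = k' := by
  refine div_eq_one.1 (eq_one_of_restrict α₀ α₁ n fun w hw => ?_)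
  rw [map_div, h w hw, div_self']

theorem exists_leaf_prefix (t : BTree) :
    ∃ n, ∀ w : List Bool, n ≤ w.length → ∃ (l : t.Leaf) (m : List Bool), w = l.1 ++ m := by
  induction t with
  | leaf => exact ⟨0, fun w _ => ⟨⟨[], trivial⟩, w, rfl⟩⟩
  | node a b iha ihb =>
    obtain ⟨n, hn⟩ := iha
    obtain ⟨n', hn'⟩ := ihb
    refine ⟨n + n' + 1, fun w hw => ?_⟩
    match w, hw with
    | false :: w, hw =>
      obtain ⟨l, m, rfl⟩ := hn w (by simp at hw; omega)
      exact ⟨⟨false :: l.1, l.2⟩, m, rfl⟩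
    | true :: w, hw =>
      obtain ⟨l, m, rfl⟩ := hn' w (by simp at hw; omega)
      exact ⟨⟨true :: l.1, l.2⟩, m, rfl⟩

theorem exists_restrict_eq_rootCls (k : LimitGroup α₀ α₁) :
    ∃ n, ∀ w : List Bool, n ≤ w.length → ∃ g, restrict α₀ α₁ w k = rootCls α₀ α₁ g := by
  obtain ⟨t, g, rfl⟩ := exists_eq_cls α₀ α₁ k
  obtain ⟨n, hn⟩ := exists_leaf_prefix t
  refine ⟨n, fun w hw => ?_⟩
  obtain ⟨l, m, rfl⟩ := hn w hw
  exact ⟨_, by rw [restrict_append, restrict_cls_leaf, restrict_rootCls]⟩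

/-- An element of `V` acts on each long enough word by exchanging a prefix. -/
theorem exists_carries_word (v : ThompsonV) (N : ℕ) :
    ∃ n, ∀ w : List Bool, n ≤ w.length →
      ∃ w' : List Bool, N ≤ w'.length ∧ ∀ x, v.1 (cat w x) = cat w' x := by
  obtain ⟨t, s, b, h⟩ := v.2
  obtain ⟨n, hn⟩ := exists_leaf_prefix t
  -- The first `n` letters reach a leaf, whose word is exchanged; the other `N` survive in the image
  -- and bound its length from below.
  refine ⟨n + N, fun w hw => ?_⟩
  obtain ⟨l, m, hlm⟩ := hn (w.take n) (by simp; omega)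
  refine ⟨(b l).1 ++ (m ++ w.drop n), by simp; omega, fun x => ?_⟩
  rw [cat_append, ← h, ← cat_append, ← List.append_assoc, ← hlm, List.take_append_drop]

/-- Below, the Jones action is computed only through this formula. The word `w` may end above the
leaves of the tree, so both words are first extended by `n` letters. -/
theorem restrict_jonesAction (v : ThompsonV) {w w' : List Bool}
    (hv : ∀ x, v.1 (cat w x) = cat w' x) (k : LimitGroup α₀ α₁) :
    restrict α₀ α₁ w' (jonesAction α₀ α₁ v k) = restrict α₀ α₁ w k := by
  obtain ⟨t, s, b, g, -, h, rfl, -⟩ := exists_rep α₀ α₁ v k k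
  obtain ⟨n, hn⟩ := exists_leaf_prefix t
  refine eq_of_restrict α₀ α₁ n fun m hm => ?_
  obtain ⟨l, e, hle⟩ := hn (w ++ m) (by simp; omega)
  have hw' : w' ++ m = (b l).1 ++ e := cat_left_injective fun x => by
    rw [cat_append, ← hv, ← cat_append, hle, cat_append, h, cat_append]
  rw [← restrict_append, ← restrict_append, hle, hw', restrict_append, restrict_append]
  congr 1
  change restrict α₀ α₁ (b l).1 (jonesFun α₀ α₁ v (cls α₀ α₁ g)) = _
  rw [jonesFun_cls α₀ α₁ v h, restrict_cls_leaf, restrict_cls_leaf]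
  simp

end Restriction

/-! ### Disjoint cones and the elements of `V` that swap them -/

/-- Two words whose cones are disjoint. -/
def Disj (p q : List Bool) : Prop := ∀ x y, cat p x ≠ cat q y

theorem Disj.symm {p q : List Bool} (h : Disj p q) : Disj q p := fun x y e => h y x e.symm

theorem Disj.append {p q : List Bool} (h : Disj p q) (e f : List Bool) :
    Disj (p ++ e) (q ++ f) := by
  intro x y
  rw [cat_append, cat_append]
  exact h _ _

theorem cat_injective (w : List Bool) : Function.Injective (cat w) := by
  induction w with
  | nil => exact fun _ _ h => h
  | cons a w ih => exact fun x y h => ih (cat_cons_inj h).2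

theorem Disj.append_left (u : List Bool) {p q : List Bool} (h : Disj p q) :
    Disj (u ++ p) (u ++ q) := by
  intro x y e
  rw [cat_append, cat_append] at e
  exact h _ _ (cat_injective u e)

theorem disj_cons_of_ne {a b : Bool} (h : a ≠ b) (p q : List Bool) : Disj (a :: p) (b :: q) :=
  fun _ _ e => h (cat_cons_inj e).1

theorem Disj.of_cons {a : Bool} {p q : List Bool} (h : Disj (a :: p) (a :: q)) : Disj p q :=
  fun x y e => h x y (by simp [cat, e])

theorem exists_append_or_disj (p q : List Bool) :
    (∃ e, q = p ++ e) ∨ (∃ e, p = q ++ e) ∨ Disj p q := by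
  induction p generalizing q with
  | nil => exact Or.inl ⟨q, rfl⟩
  | cons a p ih =>
    cases q with
    | nil => exact Or.inr (Or.inl ⟨_, rfl⟩)
    | cons b q =>
      rcases eq_or_ne a b with rfl | hab
      · rcases ih q with ⟨e, rfl⟩ | ⟨e, rfl⟩ | h
        · exact Or.inl ⟨e, rfl⟩
        · exact Or.inr (Or.inl ⟨e, rfl⟩)
        · exact Or.inr (Or.inr (h.append_left [a]))
      · exact Or.inr (Or.inr (disj_cons_of_ne hab p q))

theorem disj_of_isLeaf {t : BTree} {p q : List Bool} (hp : t.IsLeaf p) (hq : t.IsLeaf q)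
    (hne : p ≠ q) : Disj p q := by
  rcases exists_append_or_disj p q with ⟨e, he⟩ | ⟨e, he⟩ | h
  · exact absurd (isLeaf_unique t hq hp (m := []) (by simpa using he)).1.symm hne
  · exact absurd (isLeaf_unique t hp hq (m := []) (by simpa using he)).1 hne
  · exact h

theorem exists_isLeaf (p : List Bool) : ∃ t : BTree, t.IsLeaf p := by
  induction p with
  | nil => exact ⟨leaf, trivial⟩
  | cons a p ih =>
    obtain ⟨t, ht⟩ := ih
    cases a
    · exact ⟨node t leaf, ht⟩
    · exact ⟨node leaf t, ht⟩

theorem exists_isLeaf_of_disj {p q : List Bool} (h : Disj p q) :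
    ∃ t : BTree, t.IsLeaf p ∧ t.IsLeaf q := by
  induction p generalizing q with
  | nil => exact absurd rfl (h (cat q fun _ => true) fun _ => true)
  | cons a p ih =>
    cases q with
    | nil => exact absurd rfl (h (fun _ => true) (cat (a :: p) fun _ => true))
    | cons b q =>
      rcases eq_or_ne a b with rfl | hab
      · obtain ⟨t, hp, hq⟩ := ih h.of_cons
        cases a
        · exact ⟨node t leaf, hp, hq⟩
        · exact ⟨node leaf t, hp, hq⟩
      · obtain ⟨t, ht⟩ := exists_isLeaf p
        obtain ⟨s, hs⟩ := exists_isLeaf q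
        match a, b, hab with
        | false, true, _ => exact ⟨node t s, ht, hs⟩
        | true, false, _ => exact ⟨node s t, ht, hs⟩

open Classical in
/-- The map that exchanges the cones of two disjoint words and fixes all other points. -/
def swapFun (p q : List Bool) (z : Cantor) : Cantor :=
  if h : ∃ x, z = cat p x then cat q h.choose
  else if h : ∃ x, z = cat q x then cat p h.choose else z

theorem swapFun_left (p q : List Bool) (x : Cantor) : swapFun p q (cat p x) = cat q x := by
  have h : ∃ y, cat p x = cat p y := ⟨x, rfl⟩
  rw [swapFun, dif_pos h, ← cat_injective p h.choose_spec]

theorem swapFun_right {p q : List Bool} (hpq : Disj p q) (x : Cantor) :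
    swapFun p q (cat q x) = cat p x := by
  have h : ∃ y, cat q x = cat q y := ⟨x, rfl⟩
  rw [swapFun, dif_neg fun ⟨y, hy⟩ => hpq y x hy.symm, dif_pos h, ← cat_injective q h.choose_spec]

theorem swapFun_of_ne {p q : List Bool} {z : Cantor} (hp : ∀ x, z ≠ cat p x)
    (hq : ∀ x, z ≠ cat q x) : swapFun p q z = z := by
  rw [swapFun, dif_neg fun ⟨y, hy⟩ => hp y hy, dif_neg fun ⟨y, hy⟩ => hq y hy]

theorem cone_cases (p q : List Bool) (z : Cantor) :
    (∃ x, z = cat p x) ∨ (∃ x, z = cat q x) ∨ ((∀ x, z ≠ cat p x) ∧ ∀ x, z ≠ cat q x) := by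
  by_cases h : ∃ x, z = cat p x
  · exact Or.inl h
  · by_cases h' : ∃ x, z = cat q x
    · exact Or.inr (Or.inl h')
    · exact Or.inr (Or.inr ⟨not_exists.1 h, not_exists.1 h'⟩)

theorem swapFun_involutive {p q : List Bool} (h : Disj p q) :
    Function.Involutive (swapFun p q) := by
  intro z
  rcases cone_cases p q z with ⟨x, rfl⟩ | ⟨x, rfl⟩ | ⟨hp, hq⟩
  · rw [swapFun_left, swapFun_right h]
  · rw [swapFun_right h, swapFun_left]
  · rw [swapFun_of_ne hp hq, swapFun_of_ne hp hq]

/-- The element of `V` that exchanges the cones of two disjoint words. -/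
def coneSwap (p q : List Bool) (h : Disj p q) : ThompsonV :=
  ⟨(swapFun_involutive h).toPerm, by
    classical
    obtain ⟨t, hp, hq⟩ := exists_isLeaf_of_disj h
    refine ⟨t, t, Equiv.swap ⟨p, hp⟩ ⟨q, hq⟩, fun l x => ?_⟩
    change swapFun p q (cat l.1 x) = _
    rcases eq_or_ne l ⟨p, hp⟩ with rfl | h1
    · rw [swapFun_left, Equiv.swap_apply_left]
    rcases eq_or_ne l ⟨q, hq⟩ with rfl | h2
    · rw [swapFun_right h, Equiv.swap_apply_right]
    rw [Equiv.swap_apply_of_ne_of_ne h1 h2, swapFun_of_ne]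
    · exact fun y => disj_of_isLeaf l.2 hp (fun e => h1 (Subtype.ext e)) x y
    · exact fun y => disj_of_isLeaf l.2 hq (fun e => h2 (Subtype.ext e)) x y⟩

section ConeSwap

variable {p q : List Bool} (h : Disj p q)

theorem coneSwap_left (x : Cantor) : (coneSwap p q h).1 (cat p x) = cat q x := swapFun_left p q x

theorem coneSwap_right (x : Cantor) : (coneSwap p q h).1 (cat q x) = cat p x := swapFun_right h x

theorem coneSwap_of_ne {z : Cantor} (hp : ∀ x, z ≠ cat p x) (hq : ∀ x, z ≠ cat q x) :
    (coneSwap p q h).1 z = z := swapFun_of_ne hp hq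

theorem coneSwap_of_disj {r : List Bool} (hp : Disj r p) (hq : Disj r q) (x : Cantor) :
    (coneSwap p q h).1 (cat r x) = cat r x := coneSwap_of_ne h (hp x) (hq x)

theorem coneSwap_inv : (coneSwap p q h)⁻¹ = coneSwap p q h := by
  rw [inv_eq_iff_mul_eq_one]
  exact Subtype.ext (Equiv.ext (swapFun_involutive h))

theorem conj_coneSwap {p' q' : List Bool} (h' : Disj p' q') (v : ThompsonV)
    (hp : ∀ x, v.1 (cat p x) = cat p' x) (hq : ∀ x, v.1 (cat q x) = cat q' x) :
    v * coneSwap p q h * v⁻¹ = coneSwap p' q' h' := by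
  rw [mul_inv_eq_iff_eq_mul]
  refine Subtype.ext (Equiv.ext fun z => ?_)
  change v.1 ((coneSwap p q h).1 z) = (coneSwap p' q' h').1 (v.1 z)
  rcases cone_cases p q z with ⟨x, rfl⟩ | ⟨x, rfl⟩ | ⟨np, nq⟩
  · rw [coneSwap_left, hp, hq, coneSwap_left]
  · rw [coneSwap_right, hp, hq, coneSwap_right]
  · rw [coneSwap_of_ne h np nq, coneSwap_of_ne h']
    · intro x e
      rw [← hp] at e
      exact np x (v.1.injective e)
    · intro x e
      rw [← hq] at e
      exact nq x (v.1.injective e)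

theorem exists_cat_singleton (x : Cantor) : ∃ (b : Bool) (y : Cantor), x = cat [b] y :=
  ⟨x 0, fun n => x (n + 1), funext fun n => by cases n <;> rfl⟩

theorem coneSwap_eq_mul_of_halves :
    coneSwap p q h = coneSwap (p ++ [false]) (q ++ [false]) (h.append _ _) *
      coneSwap (p ++ [true]) (q ++ [true]) (h.append _ _) := by
  have hft : Disj [false] [true] := disj_cons_of_ne (by decide) _ _
  refine Subtype.ext (Equiv.ext fun z => ?_)
  rw [Subgroup.coe_mul, Equiv.Perm.mul_apply]
  rcases cone_cases p q z with ⟨x, rfl⟩ | ⟨x, rfl⟩ | ⟨np, nq⟩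
  · obtain ⟨b, y, rfl⟩ := exists_cat_singleton x
    rw [coneSwap_left, ← cat_append, ← cat_append]
    cases b
    · rw [coneSwap_of_disj _ (hft.append_left p) (h.append _ _), coneSwap_left]
    · rw [coneSwap_left, coneSwap_of_disj _ (h.symm.append _ _) (hft.symm.append_left q)]
  · obtain ⟨b, y, rfl⟩ := exists_cat_singleton x
    rw [coneSwap_right, ← cat_append, ← cat_append]
    cases b
    · rw [coneSwap_of_disj _ (h.symm.append _ _) (hft.append_left q), coneSwap_right]
    · rw [coneSwap_right, coneSwap_of_disj _ (hft.symm.append_left p) (h.append _ _)]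
  · have np' : ∀ (b : Bool) (x : Cantor), z ≠ cat (p ++ [b]) x := fun b x => by
      rw [cat_append]; exact np _
    have nq' : ∀ (b : Bool) (x : Cantor), z ≠ cat (q ++ [b]) x := fun b x => by
      rw [cat_append]; exact nq _
    rw [coneSwap_of_ne _ np nq, coneSwap_of_ne _ (np' true) (nq' true),
      coneSwap_of_ne _ (np' false) (nq' false)]

end ConeSwap

/-! ### Commuting subgroups of `V` normalized by swaps -/

/-- `a` moves the cone of `e` off itself. -/
def Moves (a : ThompsonV) (e : List Bool) : Prop := ∀ x y, a.1 (cat e x) ≠ cat e y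

theorem Moves.append {a : ThompsonV} {e : List Bool} (h : Moves a e) (f : List Bool) :
    Moves a (e ++ f) := by
  intro x y
  rw [cat_append, cat_append]
  exact h _ _

theorem Moves.conj {a v : ThompsonV} {e f : List Bool} (h : Moves a e)
    (hv : ∀ x, v.1 (cat e x) = cat f x) : Moves (v * a * v⁻¹) f := by
  intro x y he
  change v.1 (a.1 (v.1⁻¹ (cat f x))) = cat f y at he
  rw [Equiv.Perm.inv_eq_iff_eq.2 (hv x).symm, ← hv] at he
  exact h x y (v.1.injective he)

/-- The first `n` letters of a sequence. -/
def initial : ℕ → Cantor → List Bool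
  | 0, _ => []
  | n + 1, x => x 0 :: initial n fun i => x (i + 1)

theorem length_initial (n : ℕ) (x : Cantor) : (initial n x).length = n := by
  induction n generalizing x with
  | zero => rfl
  | succ n ih => simp [initial, ih]

theorem exists_eq_cat_initial (n : ℕ) (x : Cantor) : ∃ y, x = cat (initial n x) y := by
  induction n generalizing x with
  | zero => exact ⟨x, rfl⟩
  | succ n ih =>
    obtain ⟨y, hy⟩ := ih fun i => x (i + 1)
    refine ⟨y, funext fun i => ?_⟩
    cases i with
    | zero => rfl
    | succ i => exact congrFun hy i

theorem cat_apply_of_lt {w : List Bool} {i : ℕ} (hi : i < w.length) (x y : Cantor) :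
    cat w x i = cat w y i := by
  induction w generalizing i with
  | nil => simp at hi
  | cons a w ih =>
    cases i with
    | zero => rfl
    | succ i => exact ih (by simpa using hi)

theorem exists_moves {a : ThompsonV} (ha : a ≠ 1) : ∃ e, Moves a e := by
  obtain ⟨z, hz⟩ : ∃ z, a.1 z ≠ z := by
    by_contra! hc
    exact ha (Subtype.ext (Equiv.ext hc))
  obtain ⟨i, hi⟩ := Function.ne_iff.1 hz
  -- Both the initial word and its image prefix get length greater than `i`, so the letters at `i`
  -- of a point of the cone and of its image do not depend on the point.
  obtain ⟨n, hn⟩ := exists_carries_word a (i + 1)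
  obtain ⟨y, hy⟩ := exists_eq_cat_initial (n + i + 1) z
  have hl := length_initial (n + i + 1) z
  obtain ⟨w', hw', hc⟩ := hn (initial (n + i + 1) z) (by omega)
  refine ⟨initial (n + i + 1) z, fun x x' e => hi ?_⟩
  generalize initial (n + i + 1) z = w at *
  rw [hy, hc, cat_apply_of_lt (by omega) y x, ← hc, e]
  exact cat_apply_of_lt (by omega) _ _

/-- `v` normalizes the subgroup `N`, in the one direction that is needed. -/
def ConjInto (v : ThompsonV) (N : Subgroup ThompsonV) : Prop := ∀ n ∈ N, v * n * v⁻¹ ∈ N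

/-- The conjugate of `f` is supported on the image of the cone under `a`, which is disjoint from the
support of `g`. -/
theorem commute_of_supported {a f g : ThompsonV} {e : List Bool} (ha : Moves a e)
    (hf : ∀ z, (∀ x, z ≠ cat e x) → f.1 z = z) (hg : ∀ z, (∀ x, z ≠ cat e x) → g.1 z = z) :
    Commute (a * f * a⁻¹) g := by
  have hd : Equiv.Perm.Disjoint (a * f * a⁻¹).1 g.1 := by
    intro z
    by_cases hz : ∃ x, z = cat e x
    · obtain ⟨x, rfl⟩ := hz
      left
      change a.1 (f.1 (a.1⁻¹ (cat e x))) = cat e x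
      rw [hf]
      · exact a.1.apply_symm_apply _
      intro y hy
      rw [Equiv.Perm.inv_eq_iff_eq] at hy
      exact ha y x hy.symm
    · exact Or.inr (hg z (not_exists.1 hz))
  exact Subtype.ext hd.commute

theorem coneSwap_supported {e r s : List Bool} (h : Disj (e ++ r) (e ++ s)) {z : Cantor}
    (hz : ∀ x, z ≠ cat e x) : (coneSwap _ _ h).1 z = z := by
  refine coneSwap_of_ne h ?_ ?_ <;> intro x <;> rw [cat_append] <;> exact hz _

/-- A subgroup that contains an element moving a cone off itself and is normalized by the swaps
inside this cone contains these swaps. -/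
theorem coneSwap_mem_of_moves {N : Subgroup ThompsonV} {a : ThompsonV} (ha : a ∈ N)
    {e : List Bool} (hm : Moves a e)
    (hN : ∀ r s (h : Disj (e ++ r) (e ++ s)), ConjInto (coneSwap _ _ h) N)
    (r s : List Bool) (h : Disj (e ++ r) (e ++ s)) : coneSwap _ _ h ∈ N := by
  have hft : Disj [false] [true] := disj_cons_of_ne (by decide) _ _
  have h0 : Disj (e ++ (r ++ [false])) (e ++ (s ++ [false])) := by
    simpa using h.append [false] [false]
  have h1 : Disj (e ++ (r ++ [true])) (e ++ (s ++ [true])) := by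
    simpa using h.append [true] [true]
  have h01 : Disj (e ++ (r ++ [false])) (e ++ (s ++ [true])) := by
    simpa using h.append [false] [true]
  have hr : Disj (e ++ (r ++ [false])) (e ++ (r ++ [true])) :=
    (hft.append_left r).append_left e
  have hs : Disj (e ++ (s ++ [false])) (e ++ (s ++ [true])) :=
    (hft.append_left s).append_left e
  -- The involution `f` swaps the left halves, and `g₁ * g₂` exchanges left and right halves in both
  -- cones. The full swap is then the commutator of `f` and `g₁ * g₂`.
  set f := coneSwap _ _ h0 with hf
  set g₁ := coneSwap _ _ hr with hg₁
  set g₂ := coneSwap _ _ hs with hg₂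
  have hconj : (g₁ * g₂) * f * (g₁ * g₂)⁻¹ = coneSwap _ _ h1 := by
    refine conj_coneSwap h0 h1 _ (fun x => ?_) fun x => ?_
    · change g₁.1 (g₂.1 _) = _
      rw [hg₂, coneSwap_of_disj _ h0 h01, coneSwap_left]
    · change g₁.1 (g₂.1 _) = _
      rw [hg₂, coneSwap_left, coneSwap_of_disj _ h01.symm h1.symm]
  have key : coneSwap _ _ h = f * ((g₁ * g₂) * f * (g₁ * g₂)⁻¹) := by
    rw [hconj, coneSwap_eq_mul_of_halves]
    simp only [hf, List.append_assoc]
  -- With `g = g₁ * g₂`, the product of `m₁` and `m₂` is `[[a, f], g]`. It equals `[f, g]` because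
  -- `a f a⁻¹` commutes with `f` and `g`.
  have m₁ : a * (f * a⁻¹ * f⁻¹) ∈ N := N.mul_mem ha (hN _ _ h0 _ (N.inv_mem ha))
  have m₂ : g₁ * (g₂ * (a * (f * a⁻¹ * f⁻¹))⁻¹ * g₂⁻¹) * g₁⁻¹ ∈ N :=
    hN _ _ hr _ (hN _ _ hs _ (N.inv_mem m₁))
  have sf : ∀ z, (∀ x, z ≠ cat e x) → f.1 z = z := fun z hz => coneSwap_supported h0 hz
  have sg : ∀ z, (∀ x, z ≠ cat e x) → (g₁ * g₂).1 z = z := fun z hz => by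
    change g₁.1 (g₂.1 z) = z
    rw [coneSwap_supported hs hz, coneSwap_supported hr hz]
  have cf := commute_of_supported hm sf sf
  have cg := commute_of_supported hm sf sg
  have hff : f⁻¹ = f := coneSwap_inv h0
  have cx : Commute (a * f * a⁻¹) (f * (g₁ * g₂) * f⁻¹) :=
    (cf.mul_right cg).mul_right cf.inv_right
  rw [key]
  convert N.mul_mem m₁ m₂ using 1
  calc f * ((g₁ * g₂) * f * (g₁ * g₂)⁻¹)
      = (f * (g₁ * g₂) * f⁻¹) * (g₁ * g₂)⁻¹ := by rw [hff]; group
    _ = (a * f * a⁻¹) * (f * (g₁ * g₂) * f⁻¹) * (a * f * a⁻¹)⁻¹ * (g₁ * g₂)⁻¹ := by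
      rw [cx.mul_inv_cancel]
    _ = (a * (f * a⁻¹ * f⁻¹)) * (g₁ * (g₂ * (a * (f * a⁻¹ * f⁻¹))⁻¹ * g₂⁻¹) * g₁⁻¹) := by
      simp only [hff, mul_inv_rev, inv_inv, mul_assoc]

/-- Each subgroup contains all swaps inside the cone of `e`, but two transpositions of the three
disjoint subcones `00`, `01`, `1` that share `00` do not commute. -/
theorem not_commuting_of_moves_same {A B : Subgroup ThompsonV}
    (hAB : ∀ a ∈ A, ∀ b ∈ B, a * b = b * a) {a b : ThompsonV} (ha : a ∈ A) (hb : b ∈ B)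
    {e : List Bool} (hae : Moves a e) (hbe : Moves b e)
    (hN : ∀ r s (h : Disj (e ++ r) (e ++ s)),
      ConjInto (coneSwap _ _ h) A ∧ ConjInto (coneSwap _ _ h) B) : False := by
  have h1 : Disj (e ++ [false, false]) (e ++ [false, true]) :=
    ((disj_cons_of_ne (by decide) _ _).append_left [false]).append_left e
  have h2 : Disj (e ++ [false, false]) (e ++ [true]) :=
    (disj_cons_of_ne (by decide) _ _).append_left e
  have h3 : Disj (e ++ [false, true]) (e ++ [true]) :=
    (disj_cons_of_ne (by decide) _ _).append_left e
  have m1 := coneSwap_mem_of_moves ha hae (fun r s h => (hN r s h).1) _ _ h1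
  have m2 := coneSwap_mem_of_moves hb hbe (fun r s h => (hN r s h).2) _ _ h2
  have hc : (coneSwap _ _ h1).1 ((coneSwap _ _ h2).1 (cat (e ++ [false, false]) fun _ => true)) =
      (coneSwap _ _ h2).1 ((coneSwap _ _ h1).1 (cat (e ++ [false, false]) fun _ => true)) :=
    congrArg (fun v : ThompsonV => v.1 (cat (e ++ [false, false]) fun _ => true)) (hAB _ m1 _ m2)
  rw [coneSwap_left, coneSwap_left, coneSwap_of_disj h1 h2.symm h3.symm,
    coneSwap_of_disj h2 h1.symm h3] at hc
  exact h3 _ _ hc.symm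

/-- Two commuting subgroups of `V` that are normalized by enough swaps cannot both move cones. -/
theorem not_commuting_of_moves {A B : Subgroup ThompsonV}
    (hAB : ∀ a ∈ A, ∀ b ∈ B, a * b = b * a) {a b : ThompsonV} (ha : a ∈ A) (hb : b ∈ B)
    {c d : List Bool} (hac : Moves a c) (hbd : Moves b d)
    (hc : ∀ r s (h : Disj (c ++ r) (c ++ s)),
      ConjInto (coneSwap _ _ h) A ∧ ConjInto (coneSwap _ _ h) B)
    (hd : ∀ r s (h : Disj (d ++ r) (d ++ s)),
      ConjInto (coneSwap _ _ h) A ∧ ConjInto (coneSwap _ _ h) B)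
    (hcd : ∀ h : Disj c d, ConjInto (coneSwap _ _ (h.append [false] [false])) A) : False := by
  rcases exists_append_or_disj c d with ⟨e, rfl⟩ | ⟨e, rfl⟩ | h
  · exact not_commuting_of_moves_same hAB ha hb (hac.append e) hbd hd
  · exact not_commuting_of_moves_same hAB ha hb hac (hbd.append e) hc
  -- For disjoint cones, conjugating `a` by the swap of `c0` and `d0` gives an element of `A` that
  -- moves `d0`, as `b` does.
  · refine not_commuting_of_moves_same hAB (hcd h a ha) hb
      ((hac.append [false]).conj (coneSwap_left _)) (hbd.append [false]) fun r s => ?_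
    rw [List.append_assoc, List.append_assoc]
    exact hd _ _

theorem disj_false_true : Disj [false] [true] := disj_cons_of_ne (by decide) _ _

/-- The swap of `c0` and `c1` lies in `M`; conjugating it by the swap of `c1` and `d0` yields the
swap of `c0` and `d0`. -/
theorem coneSwap_mem_of_conj_mem {M : Subgroup ThompsonV} (hM : ∀ v, ConjInto v M)
    {c d : List Bool} (hc : ∀ r s (h : Disj (c ++ r) (c ++ s)), coneSwap _ _ h ∈ M)
    (h : Disj c d) : coneSwap _ _ (h.append [false] [false]) ∈ M := by
  have h1 : Disj (c ++ [false]) (c ++ [true]) := disj_false_true.append_left c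
  have h2 : Disj (c ++ [true]) (d ++ [false]) := h.append _ _
  have h3 : Disj (c ++ [false]) (d ++ [false]) := h.append _ _
  rw [← conj_coneSwap h1 h3 (coneSwap _ _ h2) (coneSwap_of_disj h2 h1 h3) (coneSwap_left h2)]
  exact hM _ _ (hc _ _ h1)

/-! ### Surjections of the fraction group onto `V` kill the limit group -/

section Projection

variable {Γ : Type*} [Group Γ] (α₀ α₁ : Γ →* Γ)

/-- The elements of the limit group that are trivial on the cone of a letter. -/
def trivialOn (b : Bool) : Subgroup (LimitGroup α₀ α₁) := (restrictLetter α₀ α₁ b).ker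

theorem commute_of_trivialOn {k k' : LimitGroup α₀ α₁} (hk : k ∈ trivialOn α₀ α₁ true)
    (hk' : k' ∈ trivialOn α₀ α₁ false) : k * k' = k' * k := by
  have hk : restrictLetter α₀ α₁ true k = 1 := hk
  have hk' : restrictLetter α₀ α₁ false k' = 1 := hk'
  refine eq_of_restrict α₀ α₁ 1 fun w hw => ?_
  obtain ⟨b, rfl⟩ := List.length_eq_one_iff.1 hw
  change restrictLetter α₀ α₁ b _ = restrictLetter α₀ α₁ b _
  cases b <;> simp [hk, hk']

theorem exists_mul_trivialOn (k : LimitGroup α₀ α₁) :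
    ∃ x ∈ trivialOn α₀ α₁ true, ∃ y ∈ trivialOn α₀ α₁ false, k = x * y := by
  obtain ⟨x, hx0, hx1⟩ := exists_restrictLetter α₀ α₁ (restrictLetter α₀ α₁ false k) 1
  refine ⟨x, hx1, x⁻¹ * k, ?_, by group⟩
  change restrictLetter α₀ α₁ false _ = 1
  rw [map_mul, map_inv, hx0, inv_mul_cancel]

theorem jonesAction_coneSwap_mem_trivialOn {k : LimitGroup α₀ α₁} {b : Bool}
    (hk : k ∈ trivialOn α₀ α₁ b) :
    jonesAction α₀ α₁ (coneSwap _ _ disj_false_true) k ∈ trivialOn α₀ α₁ !b := by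
  have hk : restrictLetter α₀ α₁ b k = 1 := hk
  change restrictLetter α₀ α₁ (!b) _ = 1
  rw [← hk]
  cases b
  · exact restrict_jonesAction α₀ α₁ _ (coneSwap_left disj_false_true) k
  · exact restrict_jonesAction α₀ α₁ _ (coneSwap_right disj_false_true) k

variable {α₀ α₁} in
/-- The limit group lies in the kernel of each surjection of the fraction group onto `V`. -/
theorem map_inl_eq_one {ψ : FractionGroup α₀ α₁ →* ThompsonV} (hψ : Function.Surjective ψ)
    (k : LimitGroup α₀ α₁) : ψ (SemidirectProduct.inl k) = 1 := by
  let ι : LimitGroup α₀ α₁ →* ThompsonV := ψ.comp SemidirectProduct.inl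
  let A := (trivialOn α₀ α₁ true).map ι
  let B := (trivialOn α₀ α₁ false).map ι
  have hconj : ∀ v k, ι (jonesAction α₀ α₁ v k) =
      ψ (SemidirectProduct.inr v) * ι k * (ψ (SemidirectProduct.inr v))⁻¹ := fun v k => by
    simp only [ι, MonoidHom.comp_apply]
    rw [SemidirectProduct.inl_aut, map_mul, map_mul, map_inv, map_inv]
  have hAB : ∀ a ∈ A, ∀ b ∈ B, a * b = b * a := by
    rintro _ ⟨x, hx, rfl⟩ _ ⟨y, hy, rfl⟩
    rw [← map_mul, ← map_mul, commute_of_trivialOn α₀ α₁ hx hy]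
  -- Surjectivity of `ψ` makes the image of the limit group normal in `V`.
  have hM : ∀ v, ConjInto v ι.range := by
    rintro v _ ⟨x, rfl⟩
    obtain ⟨g, rfl⟩ := hψ v
    refine ⟨g.1 * jonesAction α₀ α₁ g.2 x * g.1⁻¹, ?_⟩
    rw [map_mul, map_mul, hconj, map_inv]
    have hg : ψ g = ι g.1 * ψ (SemidirectProduct.inr g.2) := by
      simp only [ι, MonoidHom.comp_apply]
      rw [← map_mul, SemidirectProduct.inl_left_mul_inr_right]
    rw [hg, mul_inv_rev]
    simp only [mul_assoc]
  -- `A` and `B` are images of kernels, which are normal in the limit group.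
  have hA : ∀ m ∈ ι.range, ConjInto m A ∧ ConjInto m B := by
    rintro _ ⟨x, rfl⟩
    constructor
    · rintro _ ⟨y, hy, rfl⟩
      exact ⟨x * y * x⁻¹, (MonoidHom.normal_ker _).conj_mem y hy x, by simp⟩
    · rintro _ ⟨y, hy, rfl⟩
      exact ⟨x * y * x⁻¹, (MonoidHom.normal_ker _).conj_mem y hy x, by simp⟩
  have hle : ∀ b, (trivialOn α₀ α₁ b).map ι ≤ ι.range := fun b => by
    rintro _ ⟨y, -, rfl⟩
    exact ⟨y, rfl⟩
  have main : ∀ x ∈ trivialOn α₀ α₁ true, ι x = 1 := by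
    intro x hx
    by_contra hne
    -- Swapping the two half cones turns `x` into an element whose image lies in `B` and is
    -- conjugate to `ι x`, so `B` is nontrivial as well.
    have hy := jonesAction_coneSwap_mem_trivialOn α₀ α₁ hx
    have hne' : ι (jonesAction α₀ α₁ (coneSwap _ _ disj_false_true) x) ≠ 1 := by
      rwa [hconj, Ne, conj_eq_one_iff]
    obtain ⟨c, hc⟩ := exists_moves hne
    obtain ⟨d, hd⟩ := exists_moves hne'
    have hxA : ι x ∈ A := ⟨x, hx, rfl⟩
    have hyB : ι (jonesAction α₀ α₁ (coneSwap _ _ disj_false_true) x) ∈ B := ⟨_, hy, rfl⟩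
    have sc := coneSwap_mem_of_moves (hle _ hxA) hc fun r s h => hM _
    have sd := coneSwap_mem_of_moves (hle _ hyB) hd fun r s h => hM _
    refine not_commuting_of_moves hAB hxA hyB hc hd (fun r s h => hA _ (sc r s h))
      (fun r s h => hA _ (sd r s h)) fun h => (hA _ (coneSwap_mem_of_conj_mem hM sc h)).1
  obtain ⟨x, hx, y, hy, rfl⟩ := exists_mul_trivialOn α₀ α₁ k
  have hy' : ι y = 1 := by
    have hmem := jonesAction_coneSwap_mem_trivialOn α₀ α₁ hy
    rw [Bool.not_false] at hmem
    have h1 := main _ hmem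
    rwa [hconj, conj_eq_one_iff] at h1
  change ι (x * y) = 1
  rw [map_mul, main x hx, hy', mul_one]

end Projection

/-! ### Invariance under swaps, and supports -/

section Invariance

variable {Γ : Type*} [Group Γ] (α₀ α₁ : Γ →* Γ)

theorem jonesAction_coneSwap_eq {p q : List Bool} (h : Disj p q) {k : LimitGroup α₀ α₁}
    (hk : restrict α₀ α₁ p k = restrict α₀ α₁ q k) :
    jonesAction α₀ α₁ (coneSwap p q h) k = k := by
  -- At this length `w` is not a proper prefix of `p` or `q`: its cone lies inside one of the two
  -- cones or misses both.
  refine eq_of_restrict α₀ α₁ (p.length + q.length) fun w hw => ?_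
  have hlen : ∀ r e : List Bool, r = w ++ e → r.length ≤ p.length + q.length →
      ∃ f, w = r ++ f := by
    rintro r e rfl hr
    have : e = [] := List.length_eq_zero_iff.1 (by simp at hr; omega)
    exact ⟨[], by simp [this]⟩
  have hext : ∀ r : List Bool, r.length ≤ p.length + q.length →
      (∃ e, w = r ++ e) ∨ Disj w r := by
    intro r hr
    rcases exists_append_or_disj w r with ⟨e, he⟩ | ⟨e, he⟩ | hd
    · exact Or.inl (hlen r e he hr)
    · exact Or.inl ⟨e, he⟩
    · exact Or.inr hd
  rcases hext p (by omega) with ⟨e, rfl⟩ | hp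
  · rw [restrict_append, restrict_append, restrict_jonesAction α₀ α₁ _ (coneSwap_right h), hk]
  rcases hext q (by omega) with ⟨e, rfl⟩ | hq
  · rw [restrict_append, restrict_append, restrict_jonesAction α₀ α₁ _ (coneSwap_left h), hk]
  exact restrict_jonesAction α₀ α₁ _ (coneSwap_of_disj h hp hq) k

theorem jonesAction_eq_of_restrict_const {k : LimitGroup α₀ α₁} {n : ℕ}
    (hk : ∀ w w' : List Bool, n ≤ w.length → n ≤ w'.length →
      restrict α₀ α₁ w k = restrict α₀ α₁ w' k) (v : ThompsonV) :
    jonesAction α₀ α₁ v k = k := by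
  -- The restriction of the moved element to `w` is that of `k` to the preimage word, which must
  -- also be long.
  obtain ⟨m, hm⟩ := exists_carries_word v⁻¹ n
  refine eq_of_restrict α₀ α₁ (m + n) fun w hw => ?_
  obtain ⟨w', hw', hc⟩ := hm w (by omega)
  rw [restrict_jonesAction α₀ α₁ v (w := w')]
  · exact hk _ _ hw' (by omega)
  · intro x
    rw [← hc]
    exact v.1.apply_symm_apply _

theorem rootCls_injective (h₀ : Function.Injective α₀) (h₁ : Function.Injective α₁) :
    Function.Injective (rootCls α₀ α₁) := by
  have hw : ∀ w, Function.Injective (wordEnd α₀ α₁ w) := by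
    intro w
    induction w with
    | nil => exact Function.injective_id
    | cons b w ih => cases b <;> [exact ih.comp h₀; exact ih.comp h₁]
  refine (injective_iff_map_eq_one _).2 fun g hg => ?_
  obtain ⟨u, hu, he⟩ := (cls_eq_one_iff α₀ α₁).1 hg
  obtain ⟨n, hn⟩ := exists_leaf_prefix u
  obtain ⟨l, -, -⟩ := hn (List.replicate n true) (by simp)
  have := congrFun he l
  rw [transition_apply α₀ α₁ hu _ l ⟨[], trivial⟩ l.1 rfl] at this
  exact (map_eq_one_iff _ (hw l.1)).1 this

theorem wordEnd_ne_one (h₀ : Function.Injective α₀) (h₁ : Function.Injective α₁) {g : Γ}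
    (hg : g ≠ 1) (w : List Bool) : wordEnd α₀ α₁ w g ≠ 1 := by
  induction w generalizing g with
  | nil => exact hg
  | cons b w ih =>
    refine ih (g := letterEnd α₀ α₁ b g) ?_
    cases b
    · exact (map_ne_one_iff α₀ h₀).2 hg
    · exact (map_ne_one_iff α₁ h₁).2 hg

theorem exists_ne_one_of_nontrivial (h : Nontrivial (LimitGroup α₀ α₁)) : ∃ g : Γ, g ≠ 1 := by
  by_contra! hc
  obtain ⟨k, hk⟩ := exists_ne (1 : LimitGroup α₀ α₁)
  obtain ⟨t, g, rfl⟩ := exists_eq_cls α₀ α₁ k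
  exact hk (by rw [show g = 1 from funext fun l => hc _, cls_one])

/-- If the endomorphisms are injective and the limit group is nontrivial, there is an element that
is trivial on the cone of `1` and nontrivial on each cone contained in the cone of `0`. -/
theorem exists_full_support (h₀ : Function.Injective α₀) (h₁ : Function.Injective α₁)
    (h : Nontrivial (LimitGroup α₀ α₁)) : ∃ k : LimitGroup α₀ α₁,
      (∀ w, restrict α₀ α₁ (false :: w) k ≠ 1) ∧ ∀ w, restrict α₀ α₁ (true :: w) k = 1 := by
  obtain ⟨g, hg⟩ := exists_ne_one_of_nontrivial α₀ α₁ h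
  obtain ⟨k, hk0, hk1⟩ := exists_restrictLetter α₀ α₁ (rootCls α₀ α₁ g) 1
  refine ⟨k, fun w => ?_, fun w => by rw [restrict_cons, hk1, map_one]⟩
  rw [restrict_cons, hk0, restrict_rootCls, map_ne_one_iff _ (rootCls_injective α₀ α₁ h₀ h₁)]
  exact wordEnd_ne_one α₀ α₁ h₀ h₁ hg w

/-- If the second endomorphism is trivial, the elements of the limit group have finite support. -/
theorem exists_restrict_append_true (α : Γ →* Γ) (k : LimitGroup α 1) :
    ∃ n, ∀ w : List Bool, n ≤ w.length → restrict α 1 (w ++ [true]) k = 1 := by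
  obtain ⟨n, hn⟩ := exists_restrict_eq_rootCls α 1 k
  refine ⟨n, fun w hw => ?_⟩
  obtain ⟨g, hg⟩ := hn w hw
  rw [restrict_append, hg, restrict_rootCls]
  exact map_one (rootCls α 1)

theorem exists_restrict_eq_one (α : Γ →* Γ) (k : LimitGroup α 1) (c : List Bool) :
    ∃ e, restrict α 1 (c ++ e) k = 1 := by
  obtain ⟨n, hn⟩ := exists_restrict_append_true α k
  -- The first `n` letters only provide length; the last one applies the trivial endomorphism.
  refine ⟨List.replicate n true ++ [true], ?_⟩
  rw [← List.append_assoc]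
  exact hn _ (by simp)

end Invariance

/-! ### Equivariant morphisms between the limit groups -/

section Main

variable {Γ Λ : Type*} [Group Γ] [Group Λ] {α : Γ →* Γ} {β₀ β₁ : Λ →* Λ}

theorem not_injective_of_isEquivariant_to_finitary (hβ₀ : Function.Injective β₀)
    (hβ₁ : Function.Injective β₁) (hL : Nontrivial (LimitGroup β₀ β₁))
    {θ : LimitGroup β₀ β₁ →* LimitGroup α 1} (hθ : IsEquivariant θ) :
    ¬ Function.Injective θ := by
  intro hinj
  obtain ⟨k, hk0, hk1⟩ := exists_full_support β₀ β₁ hβ₀ hβ₁ hL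
  obtain ⟨e, he⟩ := exists_restrict_eq_one α (θ k) [false]
  obtain ⟨f, hf⟩ := exists_restrict_eq_one α (θ k) [true]
  have hd : Disj ([false] ++ e) ([true] ++ f) := disj_false_true.append e f
  have hfix := jonesAction_coneSwap_eq α 1 hd (he.trans hf.symm)
  rw [← hθ] at hfix
  have h := restrict_jonesAction β₀ β₁ _ (coneSwap_left hd) k
  rw [hinj hfix] at h
  exact hk0 e (h.symm.trans (hk1 f))

/-- Restrictions to two overlapping cones are compared through a third cone, disjoint from both, in
the other half. -/
theorem exists_disj_disj {w w' : List Bool} (hw : w ≠ []) (hw' : w' ≠ []) (n : ℕ) :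
    Disj w w' ∨ ∃ z : List Bool, n ≤ z.length ∧ Disj w z ∧ Disj w' z := by
  cases w with
  | nil => exact absurd rfl hw
  | cons a w =>
    cases w' with
    | nil => exact absurd rfl hw'
    | cons b w' =>
      rcases eq_or_ne a b with rfl | hab
      · have ha : a ≠ !a := by cases a <;> decide
        exact Or.inr ⟨(!a) :: List.replicate n true, by simp, disj_cons_of_ne ha _ _,
          disj_cons_of_ne ha _ _⟩
      · exact Or.inl (disj_cons_of_ne hab _ _)

theorem jonesAction_map_eq (hβ₀ : Function.Injective β₀) (hβ₁ : Function.Injective β₁)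
    {θ : LimitGroup α 1 →* LimitGroup β₀ β₁} (hθ : IsEquivariant θ) (v : ThompsonV)
    (a : LimitGroup α 1) : jonesAction β₀ β₁ v (θ a) = θ a := by
  obtain ⟨n, hn⟩ := exists_restrict_append_true α a
  obtain ⟨m, hm⟩ := exists_restrict_eq_rootCls β₀ β₁ (θ a)
  have hdisj : ∀ w w' : List Bool, n + m + 1 ≤ w.length → n + m + 1 ≤ w'.length → Disj w w' →
      restrict β₀ β₁ w (θ a) = restrict β₀ β₁ w' (θ a) := by
    intro w w' hw hw' hd
    obtain ⟨g, hg⟩ := hm w (by omega)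
    obtain ⟨g', hg'⟩ := hm w' (by omega)
    -- `a` is known to vanish only on `w1` and `w'1`. The extra letter costs an application of `β₁`
    -- to the values of `θ a`, undone by injectivity.
    have hd' := hd.append [true] [true]
    have hfix := jonesAction_coneSwap_eq α 1 hd'
      ((hn w (by omega)).trans (hn w' (by omega)).symm)
    have h := restrict_jonesAction β₀ β₁ _ (coneSwap_left hd') (θ a)
    rw [← hθ, hfix, restrict_append, restrict_append, hg, hg', restrict_rootCls,
      restrict_rootCls] at h
    have h' : β₁ g' = β₁ g := rootCls_injective β₀ β₁ hβ₀ hβ₁ h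
    rw [hg, hg', hβ₁ h']
  refine jonesAction_eq_of_restrict_const β₀ β₁ (n := n + m + 1) (fun w w' hw hw' => ?_) v
  rcases exists_disj_disj (w := w) (w' := w') (by rintro rfl; simp at hw)
    (by rintro rfl; simp at hw') (n + m + 1) with hd | ⟨z, hz, h1, h2⟩
  · exact hdisj w w' hw hw' hd
  · rw [hdisj w z hw hz h1, hdisj w' z hw' hz h2]

theorem not_injective_of_isEquivariant_from_finitary (hβ₀ : Function.Injective β₀)
    (hβ₁ : Function.Injective β₁) (hK : Nontrivial (LimitGroup α 1))
    {θ : LimitGroup α 1 →* LimitGroup β₀ β₁} (hθ : IsEquivariant θ) :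
    ¬ Function.Injective θ := by
  intro hinj
  obtain ⟨a, ha⟩ := exists_ne (1 : LimitGroup α 1)
  have hfix : ∀ v, jonesAction α 1 v a = a := fun v =>
    hinj ((hθ v a).trans (jonesAction_map_eq hβ₀ hβ₁ hθ v a))
  obtain ⟨n, hn⟩ := exists_restrict_append_true α a
  refine ha (eq_one_of_restrict α 1 (n + 1) fun w hw => ?_)
  -- The invariant element `a` has the same restriction to this cone as to a deep cone in the other
  -- half on which it vanishes.
  obtain ⟨b, w, rfl⟩ := List.exists_cons_of_length_eq_add_one hw
  have hb : b ≠ !b := by cases b <;> decide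
  have hd : Disj (b :: w) ((!b) :: List.replicate n true ++ [true]) := disj_cons_of_ne hb _ _
  have h := restrict_jonesAction α 1 _ (coneSwap_left hd) a
  rw [hfix] at h
  rw [← h]
  exact hn _ (by simp)

end Main

/-! ### Non-isomorphism of the fraction groups -/

/-- The elements of `V` that fix each point of the cone of a letter. -/
def coneFixer (b : Bool) : Subgroup ThompsonV where
  carrier := {v | ∀ x, v.1 (cat [b] x) = cat [b] x}
  one_mem' _ := rfl
  mul_mem' {v _} hv hw x := (congrArg v.1 (hw x)).trans (hv x)
  inv_mem' hv x := Equiv.Perm.inv_eq_iff_eq.2 (hv x).symm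

theorem commute_of_coneFixer {v w : ThompsonV} (hv : v ∈ coneFixer true)
    (hw : w ∈ coneFixer false) : v * w = w * v := by
  have hd : Equiv.Perm.Disjoint v.1 w.1 := by
    intro z
    obtain ⟨b, x, rfl⟩ := exists_cat_singleton z
    cases b
    · exact Or.inr (hw x)
    · exact Or.inl (hv x)
  exact Subtype.ext hd.commute

theorem conjInto_coneFixer {v : ThompsonV} (hv : ∀ b x, ∃ y, v.1 (cat [b] x) = cat [b] y)
    (b : Bool) : ConjInto v (coneFixer b) := by
  intro f hf x
  obtain ⟨b', y, hy⟩ := exists_cat_singleton (v.1⁻¹ (cat [b] x))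
  rw [Equiv.Perm.inv_eq_iff_eq] at hy
  obtain ⟨y', hy'⟩ := hv b' y
  obtain rfl := (cat_cons_inj (hy.trans hy')).1
  change v.1 (f.1 (v.1⁻¹ (cat [b] x))) = cat [b] x
  rw [Equiv.Perm.inv_eq_iff_eq.2 hy, hf y, hy]

section Main

variable {Γ Λ : Type*} [Group Γ] [Group Λ] {α : Γ →* Γ} {β₀ β₁ : Λ →* Λ}

/-- Conjugation in the limit group does not change supports. If `v` carried a subcone of one half
into the other, a trivial restriction would equal a nontrivial one. -/
theorem preserves_cones_of_conj {k l : LimitGroup β₀ β₁}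
    (hk0 : ∀ w, restrict β₀ β₁ (false :: w) k ≠ 1) (hk1 : ∀ w, restrict β₀ β₁ (true :: w) k = 1)
    {v : ThompsonV} (hv : jonesAction β₀ β₁ v k = l⁻¹ * k * l) (b : Bool) (x : Cantor) :
    ∃ y, v.1 (cat [b] x) = cat [b] y := by
  obtain ⟨n, hn⟩ := exists_carries_word v 1
  obtain ⟨y, hy⟩ := exists_eq_cat_initial (n + 1) (cat [b] x)
  obtain ⟨w', hw', hc⟩ := hn (initial (n + 1) (cat [b] x)) (by rw [length_initial]; omega)
  have hi : initial (n + 1) (cat [b] x) = b :: initial n x := rfl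
  have hr := restrict_jonesAction β₀ β₁ v hc k
  rw [hy, hc]
  rw [hi, hv] at hr
  match w', hw', hr with
  | b' :: w', _, hr =>
    rcases eq_or_ne b b' with rfl | hne
    · exact ⟨cat w' y, rfl⟩
    · exfalso
      rw [map_mul, map_mul, map_inv] at hr
      match b, b', hne, hr with
      | false, true, _, hr =>
        rw [hk1, mul_one, inv_mul_cancel] at hr
        exact hk0 _ hr.symm
      | true, false, _, hr =>
        rw [hk1, mul_assoc, inv_mul_eq_one, eq_comm, mul_eq_right] at hr
        exact hk0 _ hr

theorem fractionGroup_not_iso (hβ₀ : Function.Injective β₀) (hβ₁ : Function.Injective β₁)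
    (hL : Nontrivial (LimitGroup β₀ β₁)) (φ : FractionGroup α 1 ≃* FractionGroup β₀ β₁) :
    False := by
  obtain ⟨k, hk0, hk1⟩ := exists_full_support β₀ β₁ hβ₀ hβ₁ hL
  let ψ : FractionGroup β₀ β₁ →* ThompsonV := SemidirectProduct.rightHom.comp φ.symm.toMonoidHom
  let ψ' : FractionGroup α 1 →* ThompsonV := SemidirectProduct.rightHom.comp φ.toMonoidHom
  have hψ : Function.Surjective ψ :=
    SemidirectProduct.rightHom_surjective.comp φ.symm.surjective
  have hψ' : Function.Surjective ψ' := SemidirectProduct.rightHom_surjective.comp φ.surjective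
  -- Since `ψ` kills `L`, the preimage of `k` has trivial `V`-component.
  obtain ⟨u, hu⟩ : ∃ u, φ (SemidirectProduct.inl u) = SemidirectProduct.inl k := by
    refine ⟨(φ.symm (SemidirectProduct.inl k)).left, ?_⟩
    rw [← MulEquiv.eq_symm_apply]
    refine SemidirectProduct.ext rfl ?_
    exact (map_inl_eq_one hψ k).symm
  let κ : ThompsonV →* ThompsonV := ψ.comp SemidirectProduct.inr
  -- If `κ v = 1`, then `φ⁻¹` sends `v` into `K`, which `ψ'` kills.
  have hκ : ∀ v, κ v = 1 → v = 1 := by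
    intro v hv
    have h1 : φ.symm (SemidirectProduct.inr v) =
        SemidirectProduct.inl (φ.symm (SemidirectProduct.inr v)).left :=
      SemidirectProduct.ext rfl hv
    have h2 := map_inl_eq_one hψ' (φ.symm (SemidirectProduct.inr v)).left
    rw [← h1] at h2
    simpa [ψ'] using h2
  -- If `s` fixes `u`, then `g = φ s` commutes with `k`, so `g.right` sends `k` to a conjugate and
  -- preserves both half cones. As `ψ` kills `L`, `κ g.right = s`.
  have hnorm : ∀ s : ThompsonV, jonesAction α 1 s u = u →
      ∀ b, ConjInto s ((coneFixer b).map κ) := by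
    intro s hs b
    have hcomm : SemidirectProduct.inr s * SemidirectProduct.inl u =
        (SemidirectProduct.inl u * SemidirectProduct.inr s : FractionGroup α 1) := by
      refine SemidirectProduct.ext ?_ ?_ <;> simp [hs]
    have hcomm' := congrArg φ hcomm
    rw [map_mul, map_mul, hu] at hcomm'
    have hs' : ψ (φ (SemidirectProduct.inr s)) = s := by simp [ψ]
    generalize φ (SemidirectProduct.inr s) = g at hcomm' hs'
    have hleft := congrArg SemidirectProduct.left hcomm'
    simp only [SemidirectProduct.mul_left, SemidirectProduct.left_inl,
      SemidirectProduct.right_inl, map_one, MulAut.one_apply] at hleft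
    have hg : jonesAction β₀ β₁ g.right k = g.left⁻¹ * k * g.left := by
      rw [mul_assoc, ← hleft, inv_mul_cancel_left]
    have hκg : κ g.right = s := by
      rw [← hs', ← SemidirectProduct.inl_left_mul_inr_right g, map_mul, map_inl_eq_one hψ, one_mul]
      simp [κ]
    rintro _ ⟨f, hf, rfl⟩
    refine ⟨g.right * f * g.right⁻¹,
      conjInto_coneFixer (preserves_cones_of_conj hk0 hk1 hg) b f hf, ?_⟩
    rw [map_mul, map_mul, map_inv, hκg]
  have hAB : ∀ a ∈ (coneFixer true).map κ, ∀ b ∈ (coneFixer false).map κ, a * b = b * a := by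
    rintro _ ⟨x, hx, rfl⟩ _ ⟨y, hy, rfl⟩
    rw [← map_mul, ← map_mul, commute_of_coneFixer hx hy]
  -- The swap of the two quarters in the other half is a nontrivial element of the fixer. The cone
  -- moved by its image is shrunk until `u` vanishes on it.
  have hmov : ∀ b, ∃ a ∈ (coneFixer b).map κ, ∃ c, Moves a c ∧ restrict α 1 c u = 1 := by
    intro b
    have hd : Disj [!b, false] [!b, true] := disj_false_true.append_left [!b]
    have hb : b ≠ !b := by cases b <;> decide
    have hmem : coneSwap _ _ hd ∈ coneFixer b := fun x =>
      coneSwap_of_disj hd (disj_cons_of_ne hb _ _) (disj_cons_of_ne hb _ _) x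
    have hne : coneSwap _ _ hd ≠ 1 := by
      intro h1
      have h2 := coneSwap_left hd fun _ => true
      rw [h1] at h2
      exact hd _ _ h2
    obtain ⟨c, hc⟩ := exists_moves (mt (hκ _) hne)
    obtain ⟨e, he⟩ := exists_restrict_eq_one α u c
    exact ⟨_, ⟨_, hmem, rfl⟩, c ++ e, hc.append e, he⟩
  obtain ⟨a, ha, c, hac, hc⟩ := hmov true
  obtain ⟨b, hb, d, hbd, hd⟩ := hmov false
  have hsub : ∀ {c} (r : List Bool), restrict α 1 c u = 1 → restrict α 1 (c ++ r) u = 1 :=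
    fun r h => by rw [restrict_append, h, map_one]
  have hfix : ∀ {p q} (h : Disj p q), restrict α 1 p u = 1 → restrict α 1 q u = 1 →
      ∀ b, ConjInto (coneSwap p q h) ((coneFixer b).map κ) := fun h hp hq =>
    hnorm _ (jonesAction_coneSwap_eq α 1 h (hp.trans hq.symm))
  exact not_commuting_of_moves hAB ha hb hac hbd
    (fun r s h => ⟨hfix h (hsub r hc) (hsub s hc) _, hfix h (hsub r hc) (hsub s hc) _⟩)
    (fun r s h => ⟨hfix h (hsub r hd) (hsub s hd) _, hfix h (hsub r hd) (hsub s hd) _⟩)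
    fun h => hfix _ (hsub _ hc) (hsub _ hd) _

/-- The composite of `φ` with the projection to `V` kills `K`, so `φ` embeds `K` into `L`. -/
theorem nontrivial_of_fractionGroup_iso (φ : FractionGroup α 1 ≃* FractionGroup β₀ β₁)
    (hK : Nontrivial (LimitGroup α 1)) : Nontrivial (LimitGroup β₀ β₁) := by
  let ψ : FractionGroup α 1 →* ThompsonV := SemidirectProduct.rightHom.comp φ.toMonoidHom
  have hψ : Function.Surjective ψ := SemidirectProduct.rightHom_surjective.comp φ.surjective
  obtain ⟨k, hk⟩ := exists_ne (1 : LimitGroup α 1)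
  refine ⟨(φ (SemidirectProduct.inl k)).left, 1, fun h => hk ?_⟩
  have h1 : φ (SemidirectProduct.inl k) = 1 := SemidirectProduct.ext h (map_inl_eq_one hψ k)
  rw [map_eq_one_iff _ φ.injective] at h1
  exact SemidirectProduct.inl_injective (h1.trans (map_one _).symm)

end Main

end FractionGroups

end

theorem theoremB {Γ Λ : Type*} [Group Γ] [Group Λ] (α : Γ →* Γ) (β₀ β₁ : Λ →* Λ)
    (hβ₀ : Function.Injective β₀) (hβ₁ : Function.Injective β₁) :
    ((Nontrivial (FractionGroups.LimitGroup α 1) ∨ Nontrivial (FractionGroups.LimitGroup β₀ β₁)) →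
      IsEmpty (FractionGroups.FractionGroup α 1 ≃* FractionGroups.FractionGroup β₀ β₁)) ∧
    (Nontrivial (FractionGroups.LimitGroup β₀ β₁) →
      ¬ ∃ θ : FractionGroups.LimitGroup β₀ β₁ →* FractionGroups.LimitGroup α 1,
        FractionGroups.IsEquivariant θ ∧ Function.Injective θ) ∧
    ((∀ θ : FractionGroups.LimitGroup α 1 →* FractionGroups.LimitGroup β₀ β₁,
        FractionGroups.IsEquivariant θ →
          ∀ (v : FractionGroups.ThompsonV) (a : FractionGroups.LimitGroup α 1),
            FractionGroups.jonesAction β₀ β₁ v (θ a) = θ a) ∧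
      (Nontrivial (FractionGroups.LimitGroup α 1) →
        ¬ ∃ θ : FractionGroups.LimitGroup α 1 →* FractionGroups.LimitGroup β₀ β₁,
          FractionGroups.IsEquivariant θ ∧ Function.Injective θ)) := by
  refine ⟨fun h => ⟨fun φ => ?_⟩, fun hL => ?_, fun θ hθ v a => ?_, fun hK => ?_⟩
  · refine FractionGroups.fractionGroup_not_iso hβ₀ hβ₁ ?_ φ
    exact h.elim (FractionGroups.nontrivial_of_fractionGroup_iso φ) id
  · rintro ⟨θ, hθ, hinj⟩
    exact FractionGroups.not_injective_of_isEquivariant_to_finitary hβ₀ hβ₁ hL hθ hinj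
  · exact FractionGroups.jonesAction_map_eq hβ₀ hβ₁ hθ v a
  · rintro ⟨θ, hθ, hinj⟩
    exact FractionGroups.not_injective_of_isEquivariant_from_finitary hβ₀ hβ₁ hK hθ hinj
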